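/- Let $A:\mathbb N\times\mathbb N\to\mathbb N$ be the Ackermann function defined by $A(0,n)=2^n$, $A(k,0)=1$ and $A(k+1,n+1)=A(k,A(k+1,n))$ for all $k,n\in\mathbb N$; write $A_k(n)=A(k,n)$, and let $|n|$ denote the length of the binary representation of $n$ (with $|0|=1$). Then the predicate "$A_k(n)=m$" is checkable in linear time on a multitape Turing machine: there are a deterministic multitape Turing machine $M$ and a constant $D\in\mathbb N$ such that for all $k,n,m\in\mathbb N$, the machine $M$, started with the binary representations of $k$, $n$, $m$, separated by a separator symbol, on its input tape, halts after at most $D\cdot\max(|k|,|n|,|m|)$ steps, and accepts if and only if $A_k(n)=m$. -/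

import Mathlib

/-- The Ackermann function `A : ℕ × ℕ → ℕ`. We write `A_k(n)` for `ackA k n`. -/
def ackA : ℕ → ℕ → ℕ
  | 0, n => 2 ^ n
  | _ + 1, 0 => 1
  | k + 1, n + 1 => ackA k (ackA (k + 1) n)
termination_by k n => (k, n)

/-- The graph of the Ackermann function. -/
def graphA : Set (ℕ × ℕ × ℕ) :=
  {p | ackA p.1 p.2.1 = p.2.2}

/-- The usual binary representation of `n`, most significant digit first, without leading zeros;
the number `0` is represented by the one-digit string `0`. -/
def binaryRepr (n : ℕ) : List Bool :=
  if n = 0 then [false] else n.bits.reverse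

/-- The length `|n|` of the binary representation of `n` (so `|0| = 1`). -/
def binaryLength (n : ℕ) : ℕ :=
  (binaryRepr n).length

/-- The symbols in which inputs are written: binary digits, and a separator. -/
inductive InputSymbol : Type
  | digit (b : Bool)
  | sep

/-- The triple `(k, n, m)` written as a string: the three binary representations, separated by
the separator symbol. -/
def encodeTriple (p : ℕ × ℕ × ℕ) : List InputSymbol :=
  (binaryRepr p.1).map InputSymbol.digit ++ InputSymbol.sep ::
    ((binaryRepr p.2.1).map InputSymbol.digit ++ InputSymbol.sep ::
      (binaryRepr p.2.2).map InputSymbol.digit)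

/-- A deterministic multitape Turing machine, deciding by its final state, with input alphabet `α`.
It has one input tape (tape `0`) and `workTapes` further tapes, all two-way infinite. -/
structure MultitapeTM (α : Type) where
  /-- the number of tapes besides the input tape -/
  workTapes : ℕ
  /-- the tape alphabet; its default element is the blank symbol -/
  Γ : Type
  [inhabitedΓ : Inhabited Γ]
  [finiteΓ : Finite Γ]
  /-- the finite set of states -/
  Q : Type
  [finiteQ : Finite Q]
  /-- the input symbols are distinct, non-blank symbols of the tape alphabet -/
  inputSymbol : α → Γ
  inputSymbol_injective : Function.Injective inputSymbol
  inputSymbol_ne_blank : ∀ a, inputSymbol a ≠ default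
  /-- the initial state -/
  start : Q
  /-- the accepting states; a computation accepts if it halts in one of them -/
  accepting : Set Q
  /-- The transition function. Given the current state and the symbols scanned on the tapes, the
  machine either halts (`none`), or passes to a new state and on each tape writes a symbol and
  then moves the head one cell to the left or to the right, or leaves it in place (`none`). -/
  δ : Q → (Fin (workTapes + 1) → Γ) →
    Option (Q × (Fin (workTapes + 1) → Γ × Option Turing.Dir))

namespace MultitapeTM

attribute [instance] inhabitedΓ finiteΓ finiteQ

variable {α : Type} (M : MultitapeTM α)

/-- A configuration: the current state and the contents of the tapes with their head positions. -/
structure Cfg where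
  state : M.Q
  tape : Fin (M.workTapes + 1) → Turing.Tape M.Γ

/-- The initial configuration on input `w`: the word `w` is on the input tape, whose head scans the
first symbol of `w`; all other tapes are blank. -/
def init (w : List α) : M.Cfg where
  state := M.start
  tape := fun i => if i = 0 then Turing.Tape.mk₁ (w.map M.inputSymbol) else Turing.Tape.mk₁ []

/-- The action of one transition on one tape: write a symbol, then move the head. -/
def act {Γ : Type} [Inhabited Γ] (a : Γ × Option Turing.Dir) (T : Turing.Tape Γ) :
    Turing.Tape Γ :=
  match a.2 with
  | none => T.write a.1
  | some d => (T.write a.1).move d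

/-- One step of the computation; `none` if the machine halts in the configuration `c`. -/
def step (c : M.Cfg) : Option M.Cfg :=
  (M.δ c.state (fun i => (c.tape i).head)).map
    (fun r => { state := r.1, tape := fun i => act (r.2 i) (c.tape i) })

/-- On input `w` the machine halts after at most `t` steps, and it accepts if and only if `P`. -/
def DecidesWithin (w : List α) (P : Prop) (t : ℕ) : Prop :=
  ∃ c : M.Cfg, Nonempty (StateTransition.EvalsToInTime M.step (M.init w) (some c) t) ∧
    M.step c = none ∧ (c.state ∈ M.accepting ↔ P)

end MultitapeTM

/-- The predicate "`(k, n, m) ∈ S`" is checkable in linear time: there are a multitape Turing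
machine and a constant `D` such that, for all `k, n, m`, the machine on input `(k, n, m)` (written
in binary) decides whether `(k, n, m) ∈ S` in at most `D * max (|k|, |n|, |m|)` steps. -/
def CheckableInLinearTime (S : Set (ℕ × ℕ × ℕ)) : Prop :=
  ∃ (M : MultitapeTM InputSymbol) (D : ℕ), ∀ k n m : ℕ,
    M.DecidesWithin (encodeTriple (k, n, m)) ((k, n, m) ∈ S)
      (D * max (binaryLength k) (max (binaryLength n) (binaryLength m)))

/-! Every value of `ackA` is a power of two, so m has to be 2^x with x + 1 = |m|, and the question
becomes whether A_k(n) = 2^x, where x is less than the input length L. Since A_k(n) ≥ 2^n and A_k(3)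
≥ 2^(k+3), while A_k(0), A_k(1), A_k(2) do not depend on k, both k and n may be cut off at L
(`ackA_min_eq_iff`) and then kept in unary.

The search climbs the hierarchy while the argument shrinks. At level 0, 2^x = A_0(x). If 2^x =
A_i(r) and r = A_{i+1}(q), then 2^x = A_{i+1}(q+1). If r = 0, the argument stays 0, because A_i(0) =
1 for every i. For any other r, 2^x is a value at no level above i (`ackA_not_mem_range`). At the
last level, r is compared with n, by injectivity.

To find q, a bitmap of the range of A_i on {1, …, r} is kept. The function A_{i+1} enumerates the
orbit of 1 under A_i, and this allows one pass to thin the bitmap in place to the range of A_{i+1},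
counting the marks that remain (`wp_scan`, `wp_descend`). A pass takes time O(r + 1), and for r ≥ 3
the next argument is at most 3r/4, so all passes together take time linear in x plus the number of
levels (`wp_main`). Unary conversion of k and n is linear because doublings form a geometric series
(`wp_decode`).

The algorithm is written as a structured program, whose counters are head positions on work tapes.
Its remaining programs serve as states of a Turing machine that simulates it step by step
(`Represents.step`), and `wp` gives total correctness together with a step count. -/

open Turing

/-! ### A structured language for counter machines with an input tape and one bitmap -/

namespace LinearCheck

/-- The tape alphabet: the input symbols and a blank. On the work tapes `sep` marks the origin and
`digit true` marks a cell. -/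
abbrev Sym : Type := Option InputSymbol

/-- The counters. The counter `cell` is the position of the head on a tape that also carries a
bitmap. -/
inductive Reg : Type
  | cell | capK | capN | tmp | k | n | r | d | u | s | err
  deriving DecidableEq

instance : Fintype Reg :=
  ⟨{.cell, .capK, .capN, .tmp, .k, .n, .r, .d, .u, .s, .err}, fun x => by cases x <;> decide⟩

/-- The values of all variables of a program. -/
structure Store where
  /-- the input tape -/
  input : Tape Sym
  /-- the values of the counters -/
  reg : Reg → ℕ
  /-- the bitmap -/
  bits : ℕ → Bool

/-- Elementary instructions. -/
inductive Op : Type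
  | move (d : Dir)
  | inc (x : Reg)
  | dec (x : Reg)
  | mark (b : Bool)

/-- Elementary tests. -/
inductive Test : Type
  | pos (x : Reg)
  | marked
  | symbol (f : Sym → Bool)

/-- The effect of an instruction. -/
def Op.apply : Op → Store → Store
  | move d, σ => { σ with input := σ.input.move d }
  | inc x, σ => { σ with reg := Function.update σ.reg x (σ.reg x + 1) }
  | dec x, σ => { σ with reg := Function.update σ.reg x (σ.reg x - 1) }
  | mark b, σ => { σ with bits := Function.update σ.bits (σ.reg .cell) b }

/-- The outcome of a test; the origin of the bitmap counts as marked. -/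
def Test.eval : Test → Store → Bool
  | pos x, σ => decide (0 < σ.reg x)
  | marked, σ => decide (σ.reg .cell = 0) || σ.bits (σ.reg .cell)
  | symbol f, σ => f σ.input.head

/-- Structured programs. -/
inductive Prog : Type
  | done (b : Bool)
  | op (o : Op)
  | seq (p q : Prog)
  | ite (t : Test) (p q : Prog)
  | loop (t : Test) (p : Prog)

namespace Prog

/-- One step of control, given the outcomes of the tests: what remains to be executed, and the
instruction that is executed in this step. -/
def next : Prog → (Test → Bool) → Option (Prog × Option Op)
  | done _, _ => none
  | op o, _ => some (done true, some o)
  | seq p q, v =>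
    match next p v with
    | none => some (q, none)
    | some (p', o) => some (seq p' q, o)
  | ite t p q, v => some (if v t then p else q, none)
  | loop t p, v => some (if v t then seq p (loop t p) else done true, none)

/-- The programs that can remain during an execution. -/
def reach : Prog → Set Prog
  | done b => {done b}
  | op o => {op o, done true}
  | seq p q => (fun p' => seq p' q) '' reach p ∪ reach q
  | ite t p q => {ite t p q} ∪ (reach p ∪ reach q)
  | loop t p => {loop t p, done true} ∪ (fun p' => seq p' (loop t p)) '' reach p

/-- A loop unrolls only to a remainder of its body followed by the same loop, so iteration creates
no new programs. This is what makes remaining programs usable as machine states. -/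
theorem finite_reach (p : Prog) : (reach p).Finite := by
  induction p with
  | done b => exact Set.finite_singleton _
  | op o => exact (Set.finite_singleton _).insert _
  | seq p q hp hq => exact (hp.image _).union hq
  | ite t p q hp hq => exact (Set.finite_singleton _).union (hp.union hq)
  | loop t p hp => exact ((Set.finite_singleton _).insert _).union (hp.image _)

theorem self_mem_reach (p : Prog) : p ∈ reach p := by
  cases p <;> simp [reach]
  exact Or.inl (self_mem_reach _)

theorem next_mem_reach {p q q' : Prog} {v : Test → Bool} {o : Option Op} (hq : q ∈ reach p)
    (h : next q v = some (q', o)) : q' ∈ reach p := by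
  induction p generalizing q q' o with
  | done b =>
    obtain rfl : q = done b := hq
    simp [next] at h
  | op o' =>
    rcases hq with rfl | rfl
    · simp [next] at h
      simp [reach, h.1.symm]
    · simp [next] at h
  | seq a b iha ihb =>
    rcases hq with ⟨a', ha', rfl⟩ | hq
    · rcases ha : next a' v with _ | ⟨a'', o''⟩
      · simp [next, ha] at h
        exact Or.inr (h.1 ▸ self_mem_reach b)
      · simp [next, ha] at h
        exact Or.inl ⟨a'', iha ha' ha, h.1⟩
    · exact Or.inr (ihb hq h)
  | ite t a b iha ihb =>
    rcases hq with rfl | hq | hq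
    · simp only [next, Option.some.injEq, Prod.mk.injEq] at h
      rw [← h.1]
      split_ifs
      · exact Or.inr (Or.inl (self_mem_reach a))
      · exact Or.inr (Or.inr (self_mem_reach b))
    · exact Or.inr (Or.inl (iha hq h))
    · exact Or.inr (Or.inr (ihb hq h))
  | loop t a iha =>
    rcases hq with (rfl | rfl) | ⟨a', ha', rfl⟩
    · simp only [next, Option.some.injEq, Prod.mk.injEq] at h
      rw [← h.1]
      split_ifs
      · exact Or.inr ⟨a, self_mem_reach a, rfl⟩
      · exact Or.inl (Or.inr rfl)
    · simp [next] at h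
    · rcases ha : next a' v with _ | ⟨a'', o''⟩
      · simp [next, ha] at h
        exact Or.inl (Or.inl h.1.symm)
      · simp [next, ha] at h
        exact Or.inr ⟨a'', iha ha' ha, h.1⟩

/-! ### Execution, and total correctness with a step count -/

/-- One step of execution. -/
def step (p : Prog) (σ : Store) : Option (Prog × Store) :=
  (next p (fun t => t.eval σ)).map fun a => (a.1, a.2.elim σ fun o => o.apply σ)

/-- `Steps p σ N p' σ'`: in `N` steps, `p` and `σ` become `p'` and `σ'`. -/
inductive Steps : Prog → Store → ℕ → Prog → Store → Prop
  | refl (p σ) : Steps p σ 0 p σ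
  | head {p σ p₁ σ₁ N p₂ σ₂} : step p σ = some (p₁, σ₁) → Steps p₁ σ₁ N p₂ σ₂ →
      Steps p σ (N + 1) p₂ σ₂

theorem Steps.trans {p₁ p₂ p₃ : Prog} {σ₁ σ₂ σ₃ : Store} {N N' : ℕ}
    (h : Steps p₁ σ₁ N p₂ σ₂) (h' : Steps p₂ σ₂ N' p₃ σ₃) : Steps p₁ σ₁ (N + N') p₃ σ₃ := by
  induction h with
  | refl => simpa using h'
  | head hs _ ih => rw [Nat.add_right_comm]; exact .head hs (ih h')

theorem Steps.seq {p p' : Prog} {σ σ' : Store} {N : ℕ} (h : Steps p σ N p' σ') (q : Prog) :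
    Steps (seq p q) σ N (seq p' q) σ' := by
  induction h with
  | refl => exact .refl _ _
  | @head p σ p₁ σ₁ N p₂ σ₂ hs _ ih =>
    refine .head ?_ ih
    simp only [step, Option.map_eq_some_iff] at hs ⊢
    obtain ⟨⟨a, o⟩, h1, h2⟩ := hs
    simp only [Prod.mk.injEq] at h2
    exact ⟨(Prog.seq a q, o), by simp [next, h1], by simp [h2]⟩

/-- `wp p Q σ`: execution of `p` from `σ` terminates, with a store `σ'` and after a number of
steps `N` for which `Q σ' N` holds. -/
def wp (p : Prog) (Q : Store → ℕ → Prop) (σ : Store) : Prop :=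
  ∃ b σ' N, Steps p σ N (done b) σ' ∧ Q σ' N

theorem wp.mono {p : Prog} {Q Q' : Store → ℕ → Prop} {σ : Store} (h : wp p Q σ)
    (hQ : ∀ σ' N, Q σ' N → Q' σ' N) : wp p Q' σ := by
  obtain ⟨b, σ', N, h1, h2⟩ := h
  exact ⟨b, σ', N, h1, hQ _ _ h2⟩

theorem wp_done {b : Bool} {Q : Store → ℕ → Prop} {σ : Store} (h : Q σ 0) : wp (done b) Q σ :=
  ⟨b, σ, 0, .refl _ _, h⟩

theorem wp_op {o : Op} {Q : Store → ℕ → Prop} {σ : Store} (h : Q (o.apply σ) 1) :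
    wp (op o) Q σ :=
  ⟨true, _, 1, .head rfl (.refl _ _), h⟩

theorem wp_seq {p q : Prog} {Q : Store → ℕ → Prop} {σ : Store}
    (h : wp p (fun σ' N => wp q (fun σ'' N' => Q σ'' (N + 1 + N')) σ') σ) :
    wp (seq p q) Q σ := by
  obtain ⟨b, σ', N, h1, b', σ'', N', h2, h3⟩ := h
  exact ⟨b', σ'', N + 1 + N', ((h1.seq q).trans (.head rfl (.refl _ _))).trans h2, h3⟩

theorem wp_ite {t : Test} {p q : Prog} {Q : Store → ℕ → Prop} {σ : Store}
    (hp : t.eval σ = true → wp p (fun σ' N => Q σ' (N + 1)) σ)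
    (hq : t.eval σ = false → wp q (fun σ' N => Q σ' (N + 1)) σ) : wp (ite t p q) Q σ := by
  cases ht : t.eval σ with
  | true =>
    obtain ⟨b, σ', N, h1, h2⟩ := hp ht
    exact ⟨b, σ', N + 1, .head (by simp [step, next, ht]) h1, h2⟩
  | false =>
    obtain ⟨b, σ', N, h1, h2⟩ := hq ht
    exact ⟨b, σ', N + 1, .head (by simp [step, next, ht]) h1, h2⟩

/-- Loops, with an invariant `I` that refers to a potential, which pays for the steps. -/
theorem wp_loop {t : Test} {p : Prog} (I : Store → ℕ → Prop) {σ : Store} {φ : ℕ} (hI : I σ φ)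
    (hp : ∀ σ φ, I σ φ → t.eval σ = true →
      wp p (fun σ' N => ∃ φ', I σ' φ' ∧ φ' + N + 2 ≤ φ) σ) :
    wp (loop t p) (fun σ' N => ∃ φ', I σ' φ' ∧ t.eval σ' = false ∧ φ' + N ≤ φ + 1) σ := by
  induction φ using Nat.strong_induction_on generalizing σ with
  | _ φ ih =>
    cases ht : t.eval σ with
    | false =>
      exact ⟨true, σ, 1, .head (by simp [step, next, ht]) (.refl _ _), φ, hI, ht, by omega⟩
    | true =>
      obtain ⟨b, σ', N, h1, φ', h2, h3⟩ := hp σ φ hI ht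
      obtain ⟨b', σ'', N', h4, φ'', h5, h6, h7⟩ := ih φ' (by omega) h2
      -- Besides the body, an iteration spends one step on the test and one on discarding the
      -- finished body: the `+ 2` in the hypothesis. The failing test is the `+ 1` in the
      -- conclusion.
      refine ⟨b', σ'', 1 + (N + 1 + N'), ?_, φ'', h5, h6, by omega⟩
      have e : Steps (loop t p) σ 1 (seq p (loop t p)) σ :=
        .head (by simp [step, next, ht]) (.refl _ _)
      exact e.trans (((h1.seq _).trans (.head rfl (.refl _ _))).trans h4)

end Prog

/-! ### Compilation to a multitape Turing machine -/

/-- The symbol at position `z` of a work tape with bitmap `f`. -/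
def trackSym (f : ℕ → Bool) (z : ℤ) : Sym :=
  if z = 0 then some .sep else if 0 < z ∧ f z.toNat = true then some (.digit true) else none

/-- The tape `T` carries the bitmap `f`, and its head is at position `p`. -/
def IsTrack (f : ℕ → Bool) (p : ℕ) (T : Tape Sym) : Prop :=
  ∀ z : ℤ, T.nth z = trackSym f (p + z)

theorem IsTrack.head {f : ℕ → Bool} {p : ℕ} {T : Tape Sym} (h : IsTrack f p T) :
    T.head = trackSym f p := by
  simpa using h 0

theorem IsTrack.move_right {f : ℕ → Bool} {p : ℕ} {T : Tape Sym} (h : IsTrack f p T) :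
    IsTrack f (p + 1) (T.move .right) := by
  intro z
  rw [Tape.move_right_nth, h]
  push_cast
  ring_nf

theorem IsTrack.move_left {f : ℕ → Bool} {p : ℕ} {T : Tape Sym} (h : IsTrack f p T)
    (hp : 0 < p) : IsTrack f (p - 1) (T.move .left) := by
  intro z
  rw [Tape.move_left_nth, h]
  push_cast [Nat.sub_add_cancel hp, Nat.cast_sub hp]
  ring_nf

/-- At `p = 0` the written symbol is `sep` whatever `b` is, so the origin marker survives. -/
theorem IsTrack.write {f : ℕ → Bool} {p : ℕ} {T : Tape Sym} (h : IsTrack f p T) (b : Bool) :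
    IsTrack (Function.update f p b) p
      (T.write (trackSym (Function.update f p b) p)) := by
  intro z
  rw [Tape.write_nth]
  split_ifs with hz
  · simp [hz]
  · rw [h]
    unfold trackSym
    split_ifs with h1 h2 h3 h3
    · rfl
    · rfl
    · rw [Function.update_of_ne (by omega)] at h3
      exact absurd h2 h3
    · rw [Function.update_of_ne (by omega)] at h3
      exact absurd h3 h2
    · rfl

theorem trackSym_eq_sep {f : ℕ → Bool} {p : ℕ} : trackSym f p = some .sep ↔ p = 0 := by
  unfold trackSym
  split_ifs <;> simp_all

theorem trackSym_eq_none {f : ℕ → Bool} {p : ℕ} :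
    trackSym f p = none ↔ p ≠ 0 ∧ f p = false := by
  unfold trackSym
  split_ifs with h1 h2
  · simp_all
  · simp_all
  · have h3 : p ≠ 0 := by simpa using h1
    have h4 : 0 < p := Nat.pos_of_ne_zero h3
    simp_all

/-- The bitmap carried by the tape of a counter. -/
def Store.track (σ : Store) (x : Reg) : ℕ → Bool :=
  if x = .cell then σ.bits else fun _ => false

open Classical in
/-- The outcome of a test, in terms of the scanned symbols. -/
noncomputable def Test.read (a : Sym) (h : Reg → Sym) : Test → Bool
  | pos x => decide (h x ≠ some .sep)
  | marked => decide (h .cell ≠ none)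
  | symbol f => f a

open Classical in
/-- What an instruction does on the tape of a counter that scans the symbol `a`. -/
noncomputable def Op.regAct (o : Op) (x : Reg) (a : Sym) : Sym × Option Dir :=
  match o with
  | move _ => (a, none)
  | inc y => (a, if x = y then some .right else none)
  | dec y => (a, if x = y ∧ a ≠ some .sep then some .left else none)
  | mark b =>
    (if x = .cell ∧ a ≠ some .sep then (if b then some (.digit true) else none) else a, none)

/-- What an instruction does on the input tape. -/
def Op.inputAct (o : Op) : Option Dir :=
  match o with
  | move d => some d
  | _ => none

/-- An enumeration of the counters. -/
noncomputable def regEquiv : Reg ≃ Fin (Fintype.card Reg) := Fintype.equivFin Reg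

instance : Finite InputSymbol :=
  Finite.of_surjective (fun b : Option Bool => b.elim InputSymbol.sep InputSymbol.digit)
    (fun a => by cases a with
      | digit b => exact ⟨some b, rfl⟩
      | sep => exact ⟨none, rfl⟩)

open Classical in
/-- The Turing machine that executes a program, after marking the origins of all work tapes. -/
noncomputable def machine (P : Prog) : MultitapeTM InputSymbol where
  workTapes := Fintype.card Reg
  Γ := Sym
  Q := Option (P.reach)
  finiteQ := by
    have := P.finite_reach.to_subtype
    infer_instance
  inputSymbol := some
  inputSymbol_injective := Option.some_injective _
  inputSymbol_ne_blank := fun _ h => by cases h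
  start := none
  accepting := {q | ∃ h, q = some ⟨.done true, h⟩}
  δ := fun q h =>
    match q with
    | none => some (some ⟨P, P.self_mem_reach⟩,
        Fin.cases (h 0, none) (fun _ => (some .sep, none)))
    | some q =>
      match hn : Prog.next q.1 (Test.read (h 0) fun x => h (regEquiv x).succ) with
      | none => none
      | some (q', o) => some (some ⟨q', Prog.next_mem_reach q.2 hn⟩,
          Fin.cases (h 0, o.bind Op.inputAct)
            (fun j => o.elim (h j.succ, none) fun o => o.regAct (regEquiv.symm j) (h j.succ)))

/-- The configuration `c` represents the program `p` and the store `σ`. -/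
structure Represents {P : Prog} (p : Prog) (σ : Store) (c : (machine P).Cfg) : Prop where
  state : ∃ h : p ∈ P.reach, c.state = some ⟨p, h⟩
  input : c.tape 0 = σ.input
  track : ∀ x, IsTrack (σ.track x) (σ.reg x) (c.tape (regEquiv x).succ)

theorem act_head_none {Γ : Type} [Inhabited Γ] (T : Tape Γ) :
    MultitapeTM.act (T.head, none) T = T := by
  simp [MultitapeTM.act]

theorem act_head_some {Γ : Type} [Inhabited Γ] (T : Tape Γ) (d : Dir) :
    MultitapeTM.act (T.head, some d) T = T.move d := by
  simp [MultitapeTM.act]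

theorem IsTrack.act_regAct {σ : Store} {x : Reg} {T : Tape Sym}
    (h : IsTrack (σ.track x) (σ.reg x) T) (o : Op) :
    IsTrack ((o.apply σ).track x) ((o.apply σ).reg x)
      (MultitapeTM.act (o.regAct x T.head) T) := by
  -- The origin marker is how the machine sees that a counter is zero; it makes `dec` truncated and
  -- `mark` harmless at the origin.
  have hh : T.head = some .sep ↔ σ.reg x = 0 := by rw [h.head, trackSym_eq_sep]
  cases o with
  | move d =>
    simp only [Op.regAct, act_head_none]
    exact h
  | inc y =>
    by_cases hxy : x = y
    · subst hxy
      simp only [Op.regAct, if_true, act_head_some, Op.apply, Function.update_self]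
      exact h.move_right
    · simp only [Op.regAct, hxy, if_false, act_head_none, Op.apply, ne_eq, not_false_eq_true,
        Function.update_of_ne]
      exact h
  | dec y =>
    by_cases hxy : x = y
    · subst hxy
      by_cases h0 : σ.reg x = 0
      · simp only [Op.regAct, Op.apply, hh.2 h0, Function.update_self, h0]
        rw [← hh.2 h0, if_neg (by simp), act_head_none]
        rw [h0] at h
        exact h
      · simp only [Op.regAct, Op.apply, Function.update_self]
        rw [if_pos ⟨rfl, fun e => h0 (hh.1 e)⟩, act_head_some]
        exact h.move_left (Nat.pos_of_ne_zero h0)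
    · simp only [Op.regAct, hxy, false_and, if_false, act_head_none, Op.apply, ne_eq,
        not_false_eq_true, Function.update_of_ne]
      exact h
  | mark b =>
    by_cases hx : x = .cell
    · subst hx
      have h' : IsTrack σ.bits (σ.reg .cell) T := by simpa [Store.track] using h
      have hw := h'.write b
      simp only [Op.regAct, Op.apply, Store.track, if_true]
      convert hw using 1
      simp only [MultitapeTM.act]
      congr 1
      by_cases h0 : σ.reg .cell = 0
      · simp [h0, hh.2 h0, trackSym]
      · rw [if_pos ⟨rfl, fun e => h0 (hh.1 e)⟩]
        cases b <;> simp [trackSym, h0]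
    · have e : Op.regAct (.mark b) x T.head = (T.head, none) := by simp [Op.regAct, hx]
      rw [e, act_head_none]
      simpa [Op.apply, Store.track, hx] using h

theorem Test.read_eq {σ : Store} {h : Reg → Sym}
    (hh : ∀ x, h x = trackSym (σ.track x) (σ.reg x)) :
    Test.read σ.input.head h = fun t => t.eval σ := by
  funext t
  cases t with
  | pos x => simp [Test.read, Test.eval, hh, trackSym_eq_sep, Nat.pos_iff_ne_zero]
  | marked =>
    by_cases h0 : σ.reg .cell = 0
    · simp [Test.read, Test.eval, hh, h0, trackSym]
    · simp [Test.read, Test.eval, hh, trackSym_eq_none, h0, Store.track]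
  | symbol f => rfl

theorem Represents.read_eq {P p : Prog} {σ : Store} {c : (machine P).Cfg}
    (h : Represents p σ c) :
    Test.read (c.tape 0).head (fun x => (c.tape (regEquiv x).succ).head) =
      fun t => t.eval σ := by
  rw [h.input]
  exact Test.read_eq fun x => (h.track x).head

theorem Represents.step_none {P : Prog} {b : Bool} {σ : Store} {c : (machine P).Cfg}
    (h : Represents (.done b) σ c) : (machine P).step c = none := by
  obtain ⟨hm, hs⟩ := h.state
  simp only [MultitapeTM.step, hs, Option.map_eq_none_iff]
  simp only [machine]
  split
  · rfl
  · rename_i hn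
    simp [Prog.next] at hn

theorem Represents.step {P p p' : Prog} {σ σ' : Store} {c : (machine P).Cfg}
    (h : Represents p σ c) (hs : p.step σ = some (p', σ')) :
    ∃ c', (machine P).step c = some c' ∧ Represents p' σ' c' := by
  obtain ⟨hm, hst⟩ := h.state
  simp only [Prog.step, Option.map_eq_some_iff] at hs
  obtain ⟨⟨q', o⟩, hn, he⟩ := hs
  obtain ⟨rfl, rfl⟩ := Prod.mk.inj he
  rw [← h.read_eq] at hn
  have hδ : (machine P).δ c.state (fun i => (c.tape i).head) =
      some (some ⟨q', Prog.next_mem_reach hm hn⟩,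
          Fin.cases ((c.tape 0).head, o.bind Op.inputAct)
            (fun j => o.elim ((c.tape j.succ).head, none)
              fun o => o.regAct (regEquiv.symm j) (c.tape j.succ).head)) := by
    rw [hst]
    simp only [machine]
    split
    · rename_i hn'
      exact absurd (hn.symm.trans hn') (by simp)
    · rename_i q'' o' hn'
      obtain ⟨rfl, rfl⟩ := Prod.mk.inj (Option.some.inj (hn.symm.trans hn'))
      rfl
  refine ⟨_, by rw [MultitapeTM.step, hδ]; rfl, ⟨_, rfl⟩, ?_, ?_⟩
  · cases o with
    | none => exact (act_head_none _).trans h.input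
    | some o =>
      cases o with
      | move d => exact (act_head_some _ _).trans (by rw [h.input]; rfl)
      | _ => exact (act_head_none _).trans h.input
  · intro x
    cases o with
    | none =>
      have := h.track x
      rw [← act_head_none (c.tape (regEquiv x).succ)] at this
      exact this
    | some o =>
      have := (h.track x).act_regAct o
      -- The transition function recovers the counter from the tape index, so `x` is rewritten as
      -- its round trip through `regEquiv`, only where it selects the action.
      conv at this => enter [3, 1, 2]; rw [← regEquiv.symm_apply_apply x]
      exact this

theorem Represents.steps {P p p' : Prog} {σ σ' : Store} {N : ℕ} {c : (machine P).Cfg}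
    (h : Represents p σ c) (hs : p.Steps σ N p' σ') :
    ∃ c', (flip bind (machine P).step)^[N] (some c) = some c' ∧ Represents p' σ' c' := by
  induction hs generalizing c with
  | refl => exact ⟨c, rfl, h⟩
  | head hs _ ih =>
    obtain ⟨c₁, h1, h2⟩ := h.step hs
    obtain ⟨c₂, h3, h4⟩ := ih h2
    refine ⟨c₂, ?_, h4⟩
    rw [Function.iterate_succ_apply]
    have : flip bind (machine P).step (some c) = some c₁ := h1
    rw [this, h3]

/-- The store in which a program is started on the input `w`. -/
def Store.init (w : List InputSymbol) : Store where
  input := Tape.mk₁ (w.map some)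
  reg := fun _ => 0
  bits := fun _ => false

theorem isTrack_init : IsTrack (fun _ => false) 0 ((Tape.mk₁ [] : Tape Sym).write (some .sep)) := by
  intro z
  have h0 : ∀ z : ℤ, (Tape.mk₁ [] : Tape Sym).nth z = none := by
    rintro ((_ | n) | n)
    · rfl
    · rfl
    · rfl
  rw [Tape.write_nth]
  simp [trackSym, h0]

theorem exists_step_init (P : Prog) (w : List InputSymbol) :
    ∃ c, (machine P).step ((machine P).init w) = some c ∧ Represents P (Store.init w) c := by
  refine ⟨_, rfl, ⟨P.self_mem_reach, rfl⟩, act_head_none _, fun x => ?_⟩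
  have : (Store.init w).track x = fun _ => false := by
    simp [Store.track, Store.init]
  rw [this]
  exact isTrack_init

/-- A program followed by a final test yields a machine that accepts if the test fails. -/
theorem decidesWithin_machine {p : Prog} {t : Test} {w : List InputSymbol} {S : Prop} {B : ℕ}
    (h : p.wp (fun σ N => (t.eval σ = false ↔ S) ∧ N + 3 ≤ B) (Store.init w)) :
    (machine (.seq p (.ite t (.done false) (.done true)))).DecidesWithin w S B := by
  set P : Prog := .seq p (.ite t (.done false) (.done true))
  obtain ⟨b, σ, N, hs, ht, hN⟩ := h
  obtain ⟨c₀, hc₀, hr₀⟩ := exists_step_init P w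
  have h1 : P.Steps (Store.init w) (N + 2) (.done (!t.eval σ)) σ := by
    refine (hs.seq _).trans (.head rfl (.head ?_ (.refl _ _)))
    cases ht : t.eval σ <;> simp [Prog.step, Prog.next, ht]
  obtain ⟨c, hc, hr⟩ := hr₀.steps h1
  -- One step marks the origins, and after `p` one step leaves the sequence and one performs the
  -- test.
  refine ⟨c, ⟨⟨⟨N + 2 + 1, ?_⟩, hN⟩⟩, hr.step_none, ?_⟩
  · rw [Function.iterate_succ_apply]
    exact (congrArg _ hc₀).trans hc
  · obtain ⟨hm, hst⟩ := hr.state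
    rw [hst, ← ht]
    constructor
    · rintro ⟨_, he⟩
      simpa using he
    · intro he
      have hd : Prog.done (!t.eval σ) = .done true := by simp [he]
      exact ⟨hd ▸ hm, by simp [he]⟩

/-! ### The Ackermann function -/

theorem ackA_zero_left (n : ℕ) : ackA 0 n = 2 ^ n := by
  rw [ackA]

theorem ackA_zero_right (k : ℕ) : ackA k 0 = 1 := by
  cases k <;> simp [ackA]

theorem ackA_succ_succ (k n : ℕ) : ackA (k + 1) (n + 1) = ackA k (ackA (k + 1) n) := by
  rw [ackA]

theorem ackA_one (k : ℕ) : ackA k 1 = 2 := by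
  induction k with
  | zero => simp [ackA_zero_left]
  | succ k ih => rw [ackA_succ_succ, ackA_zero_right, ih]

theorem ackA_two (k : ℕ) : ackA k 2 = 4 := by
  induction k with
  | zero => simp [ackA_zero_left]
  | succ k ih => rw [ackA_succ_succ, ackA_one, ih]

/-- By double induction: A_{k+1}(n+1) is at least 2 to the power A_{k+1}(n), and A_{k+1}(n) ≥ 2^n ≥
n + 1. -/
theorem two_pow_le_ackA (k n : ℕ) : 2 ^ n ≤ ackA k n := by
  induction k generalizing n with
  | zero => rw [ackA_zero_left]
  | succ k ihk =>
    induction n with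
    | zero => rw [ackA_zero_right, pow_zero]
    | succ n ihn =>
      rw [ackA_succ_succ]
      refine le_trans (Nat.pow_le_pow_right (by norm_num) ?_) (ihk _)
      exact Nat.lt_two_pow_self.trans_le ihn

theorem ackA_strictMono (k : ℕ) : StrictMono (ackA k) := by
  refine strictMono_nat_of_lt_succ fun n => ?_
  cases k with
  | zero => simp [ackA_zero_left, pow_succ]
  | succ k =>
    rw [ackA_succ_succ]
    exact Nat.lt_two_pow_self.trans_le (two_pow_le_ackA _ _)

theorem exists_ackA_eq_two_pow (k n : ℕ) : ∃ y, ackA k n = 2 ^ y := by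
  induction k generalizing n with
  | zero => exact ⟨n, ackA_zero_left n⟩
  | succ k ih =>
    cases n with
    | zero => exact ⟨0, ackA_zero_right _⟩
    | succ n => rw [ackA_succ_succ]; exact ih _

theorem range_ackA_subset {i k : ℕ} (h : i ≤ k) : Set.range (ackA k) ⊆ Set.range (ackA i) := by
  induction h with
  | refl => exact subset_rfl
  | @step k _ ih =>
    refine subset_trans ?_ ih
    rintro _ ⟨n, rfl⟩
    cases n with
    | zero => exact ⟨0, by rw [ackA_zero_right, ackA_zero_right]⟩
    | succ n => exact ⟨_, (ackA_succ_succ k n).symm⟩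

/-- A_{k+1}(3) = A_k(A_{k+1}(2)) = A_k(4), and going from argument 3 to argument 4 at least doubles
the value. Argument 3 is the first at which the value grows with the level. -/
theorem two_pow_le_ackA_three (k : ℕ) : 2 ^ (k + 3) ≤ ackA k 3 := by
  induction k with
  | zero => rw [ackA_zero_left]
  | succ k ih =>
    have h : 2 * ackA k 3 ≤ ackA k 4 := by
      cases k with
      | zero => simp [ackA_zero_left]
      | succ k =>
        rw [ackA_succ_succ k 3]
        refine le_trans ?_ (two_pow_le_ackA _ _)
        generalize ackA (k + 1) 3 = a
        cases a with
        | zero => simp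
        | succ a =>
          have := Nat.lt_two_pow_self (n := a)
          rw [pow_succ]
          omega
    have e : 2 ^ (k + 1 + 3) = 2 * 2 ^ (k + 3) := by ring
    rw [ackA_succ_succ, ackA_two, e]
    omega

/-- Large arguments may be truncated when a value of the Ackermann function is tested. -/
theorem ackA_min_eq_iff {k n x L : ℕ} (hx : x < L) :
    ackA (min k L) (min n L) = 2 ^ x ↔ ackA k n = 2 ^ x := by
  have hlt : 2 ^ x < 2 ^ L := Nat.pow_lt_pow_right (by norm_num) hx
  -- An argument or a level that reaches `L` makes both sides false, except for arguments up to 2,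
  -- where the level is irrelevant.
  have hn : ∀ i j, L ≤ j → ackA i j ≠ 2 ^ x := fun i j hj =>
    ne_of_gt (hlt.trans_le ((Nat.pow_le_pow_right (by norm_num) hj).trans (two_pow_le_ackA i j)))
  have hk : ∀ i j, L ≤ i → 3 ≤ j → ackA i j ≠ 2 ^ x := fun i j hi hj =>
    ne_of_gt (hlt.trans_le (((Nat.pow_le_pow_right (by norm_num) (by omega)).trans
      (two_pow_le_ackA_three i)).trans ((ackA_strictMono i).monotone hj)))
  rcases le_total n L with h1 | h1
  · rw [min_eq_left h1]
    rcases le_total k L with h2 | h2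
    · rw [min_eq_left h2]
    · rw [min_eq_right h2]
      by_cases h3 : 3 ≤ n
      · exact iff_of_false (hk _ _ le_rfl h3) (hk _ _ h2 h3)
      · have : n = 0 ∨ n = 1 ∨ n = 2 := by omega
        rcases this with rfl | rfl | rfl
        · rw [ackA_zero_right, ackA_zero_right]
        · rw [ackA_one, ackA_one]
        · rw [ackA_two, ackA_two]
  · rw [min_eq_right h1]
    exact iff_of_false (hn _ _ le_rfl) (hn _ _ h1)

/-! ### Consecutive levels of the hierarchy as orbits -/

/-- `g` enumerates the orbit of `1` under `f`, and `f` starts at `1`. -/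
structure IsOrbit (f g : ℕ → ℕ) : Prop where
  strictMono : StrictMono f
  lt_apply : ∀ n, n < f n
  apply_zero : f 0 = 1
  zero : g 0 = 1
  succ : ∀ n, g (n + 1) = f (g n)

theorem IsOrbit.orbit_strictMono {f g : ℕ → ℕ} (h : IsOrbit f g) : StrictMono g :=
  strictMono_nat_of_lt_succ fun n => by rw [h.succ]; exact h.lt_apply _

theorem isOrbit_ackA (k : ℕ) : IsOrbit (ackA k) (ackA (k + 1)) where
  strictMono := ackA_strictMono k
  lt_apply n := Nat.lt_two_pow_self.trans_le (two_pow_le_ackA k n)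
  apply_zero := ackA_zero_right k
  zero := ackA_zero_right _
  succ := ackA_succ_succ k

/-- The function below the powers of two in the Ackermann hierarchy. -/
def dbl (n : ℕ) : ℕ := if n = 0 then 1 else 2 * n

theorem dbl_lt_dbl_succ (n : ℕ) : dbl n < dbl (n + 1) := by
  cases n <;> simp [dbl]

/-- The hierarchy is extended one level downwards because the positive values of `dbl`, namely 1 and
the even numbers, can be marked using a parity bit alone; the powers of two then come from the same
scan as every later level. -/
theorem isOrbit_dbl : IsOrbit dbl (ackA 0) where
  strictMono := strictMono_nat_of_lt_succ dbl_lt_dbl_succ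
  lt_apply n := by unfold dbl; split_ifs <;> omega
  apply_zero := rfl
  zero := ackA_zero_right 0
  succ n := by
    have : 0 < 2 ^ n := by positivity
    rw [ackA_zero_left, ackA_zero_left, dbl, if_neg (by omega), pow_succ, mul_comm]

theorem mem_range_dbl {i : ℕ} (hi : 0 < i) : i ∈ Set.range dbl ↔ i = 1 ∨ i % 2 = 0 := by
  constructor
  · rintro ⟨n, rfl⟩
    simp only [dbl]
    split_ifs <;> omega
  · rintro (rfl | h)
    · exact ⟨0, rfl⟩
    · exact ⟨i / 2, by simp only [dbl]; split_ifs <;> omega⟩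

/-- Ranges decrease with the level, so it suffices to exclude level `i + 1`. A value there is 1 =
A_i(0) or A_i(A_{i+1}(q)), and injectivity of A_i transfers this to `r`. -/
theorem ackA_not_mem_range {i k r : ℕ} (h : i < k) (h0 : r ≠ 0)
    (hr : r ∉ Set.range (ackA (i + 1))) : ackA i r ∉ Set.range (ackA k) := by
  intro hm
  obtain ⟨q, hq⟩ := range_ackA_subset h hm
  cases q with
  | zero =>
    rw [ackA_zero_right, ← ackA_zero_right i] at hq
    exact h0 ((ackA_strictMono i).injective hq).symm
  | succ q =>
    rw [ackA_succ_succ] at hq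
    exact hr ⟨q, (ackA_strictMono i).injective hq⟩

/-! ### Binary representations -/

/-- Append binary digits, the most significant first, to the number `a`. -/
def appendDigits (a : ℕ) (l : List Bool) : ℕ := l.foldl (fun a b => 2 * a + b.toNat) a

theorem appendDigits_cons (a : ℕ) (b : Bool) (l : List Bool) :
    appendDigits a (b :: l) = appendDigits (2 * a + b.toNat) l := rfl

theorem appendDigits_binaryRepr (n : ℕ) : appendDigits 0 (binaryRepr n) = n := by
  unfold binaryRepr
  split_ifs with h
  · simp [h, appendDigits]
  · clear h
    unfold appendDigits
    rw [List.foldl_reverse]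
    induction n using Nat.binaryRec' with
    | zero => simp
    | bit b n hn ih =>
      rw [Nat.bits_append_bit n b hn, List.foldr_cons, ih, Nat.bit_val]

theorem appendDigits_eq (a : ℕ) (l : List Bool) :
    appendDigits a l = a * 2 ^ l.length + appendDigits 0 l := by
  induction l generalizing a with
  | nil => simp [appendDigits]
  | cons b l ih =>
    rw [appendDigits_cons, ih, appendDigits_cons, ih (2 * 0 + _), List.length_cons]
    ring

theorem appendDigits_zero_lt (l : List Bool) : appendDigits 0 l < 2 ^ l.length := by
  induction l with
  | nil => simp [appendDigits]
  | cons b l ih =>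
    rw [appendDigits_cons, appendDigits_eq, List.length_cons, pow_succ]
    cases b <;> simp <;> omega

theorem appendDigits_zero_eq_zero {l : List Bool} :
    appendDigits 0 l = 0 ↔ ∀ b ∈ l, b = false := by
  induction l with
  | nil => simp [appendDigits]
  | cons b l ih =>
    rw [appendDigits_cons, appendDigits_eq]
    cases b <;> simp [ih]

/-- The digits after the first contribute less than 2^`l.length`, so they cannot make up for a
leading zero. -/
theorem appendDigits_eq_two_pow {b : Bool} {l : List Bool} :
    appendDigits 0 (b :: l) = 2 ^ l.length ↔ b = true ∧ ∀ b ∈ l, b = false := by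
  rw [appendDigits_cons, appendDigits_eq, ← appendDigits_zero_eq_zero]
  have := appendDigits_zero_lt l
  cases b <;> simp
  omega

theorem binaryRepr_ne_nil (n : ℕ) : binaryRepr n ≠ [] := by
  unfold binaryRepr
  split_ifs with h
  · simp
  · rw [Ne, List.reverse_eq_nil_iff, ← List.length_eq_zero_iff, Nat.size_eq_bits_len,
      Nat.size_eq_zero]
    exact h

theorem length_binaryRepr_two_pow (y : ℕ) : (binaryRepr (2 ^ y)).length = y + 1 := by
  rw [binaryRepr, if_neg (by positivity), List.length_reverse, Nat.size_eq_bits_len, Nat.size_pow]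

/-- Values of `ackA` are powers of two, and the length of a power of two determines its exponent. -/
theorem ackA_eq_iff {k n m x : ℕ} (hx : (binaryRepr m).length = x + 1) :
    ackA k n = m ↔ m = 2 ^ x ∧ ackA k n = 2 ^ x := by
  constructor
  · intro h
    obtain ⟨y, hy⟩ := exists_ackA_eq_two_pow k n
    have : m = 2 ^ y := h.symm.trans hy
    subst this
    rw [length_binaryRepr_two_pow] at hx
    obtain rfl : y = x := by omega
    exact ⟨rfl, h⟩
  · rintro ⟨rfl, h⟩
    exact h

open Prog

/-! ### Loops that move the value of a counter -/

/-- Set a counter to zero. -/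
def clear (x : Reg) : Prog := .loop (.pos x) (.op (.dec x))

/-- Add the value of `x` to `y`, and set `x` to zero. -/
def transfer (x y : Reg) : Prog := .loop (.pos x) (.seq (.op (.dec x)) (.op (.inc y)))

theorem wp_clear (x : Reg) (σ : Store) :
    wp (clear x) (fun σ' N => σ' = { σ with reg := Function.update σ.reg x 0 } ∧
      N ≤ 3 * σ.reg x + 1) σ := by
  refine (wp_loop (fun τ φ => ∃ a, τ = { σ with reg := Function.update σ.reg x a } ∧ φ = 3 * a)
    (φ := 3 * σ.reg x) ⟨σ.reg x, by simp, rfl⟩ ?_).mono ?_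
  · rintro _ _ ⟨a, rfl, rfl⟩ h
    refine wp_op ⟨_, ⟨a - 1, by simp [Op.apply], rfl⟩, ?_⟩
    simp [Test.eval] at h
    omega
  · rintro _ N ⟨_, ⟨a, rfl, rfl⟩, h, hN⟩
    simp [Test.eval] at h
    subst h
    exact ⟨rfl, by omega⟩

theorem wp_transfer {x y : Reg} (hxy : x ≠ y) (σ : Store) :
    wp (transfer x y) (fun σ' N => σ' = { σ with
        reg := Function.update (Function.update σ.reg x 0) y (σ.reg y + σ.reg x) } ∧
      N ≤ 5 * σ.reg x + 1) σ := by
  refine (wp_loop (fun τ φ => ∃ a b, a + b = σ.reg x ∧ τ = { σ with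
    reg := Function.update (Function.update σ.reg x a) y (σ.reg y + b) } ∧ φ = 5 * a)
    (φ := 5 * σ.reg x) ⟨σ.reg x, 0, by simp, by simp, rfl⟩ ?_).mono ?_
  · rintro _ _ ⟨a, b, hab, rfl, rfl⟩ h
    simp [Test.eval, hxy] at h
    refine wp_seq (wp_op (wp_op ⟨_, ⟨a - 1, b + 1, by omega, ?_, rfl⟩, by omega⟩))
    simp only [Op.apply, Store.mk.injEq, true_and, and_true]
    funext z
    by_cases h1 : z = y
    · subst h1
      simp [hxy.symm, add_assoc]
    · by_cases h2 : z = x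
      · subst h2
        simp [hxy]
      · simp [h1, h2]
  · rintro _ N ⟨_, ⟨a, b, hab, rfl, rfl⟩, h, hN⟩
    simp [Test.eval, hxy] at h
    subst h
    refine ⟨?_, by omega⟩
    rw [← hab, zero_add]

/-! ### From a bitmap of a function to a bitmap of the next one -/

/-- The bitmap `β` describes the range of `f` on `{1, …, R}`. -/
def Table (f : ℕ → ℕ) (R : ℕ) (β : ℕ → Bool) : Prop :=
  ∀ i, 0 < i → i ≤ R → (β i = true ↔ i ∈ Set.range f)

/-- In place, turn the bitmap of `f` into the bitmap of its orbit. The counter `u` holds the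
distance to the last mark that is kept, and `d` the number of marks to be removed before the
next one that is kept. -/
def scan : Prog :=
  .loop (.pos .r) <| .seq (.op (.dec .r)) <| .seq (.op (.inc .cell)) <|
    .ite .marked
      (.ite (.pos .d)
        (.seq (.op (.mark false)) (.seq (.op (.dec .d)) (.op (.inc .u))))
        (.seq (.op (.inc .s)) (transfer .u .d)))
      (.op (.inc .u))

/-- The invariant of `scan`, when the first `p` cells have been treated. -/
structure ScanInv (f g : ℕ → ℕ) (R : ℕ) (σ₀ σ : Store) (p c v : ℕ) : Prop where
  cell : σ.reg .cell = p
  r : p + σ.reg .r = R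
  d : c + σ.reg .d = v
  u : v + σ.reg .u = p
  orbit : g (σ.reg .s) = f v
  lt_f : p < f c
  f_le : ∀ i < c, f i ≤ p
  lt_g : p < g (σ.reg .s)
  g_le : ∀ i < σ.reg .s, g i ≤ p
  table_g : Table g p σ.bits
  table_f : ∀ i, p < i → i ≤ R → (σ.bits i = true ↔ i ∈ Set.range f)
  k : σ.reg .k = σ₀.reg .k
  n : σ.reg .n = σ₀.reg .n
  err : σ.reg .err = σ₀.reg .err

/-- Used when `c` is the number of values of `f` up to `p`: the next value is then `f c`. -/
theorem not_mem_range_of_lt {f : ℕ → ℕ} (hf : StrictMono f) {p c : ℕ} (h : ∀ i < c, f i ≤ p)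
    (h' : p + 1 < f c) : p + 1 ∉ Set.range f := by
  rintro ⟨i, hi⟩
  rcases lt_or_ge i c with hic | hic
  · have := h i hic
    omega
  · have := hf.monotone hic
    omega

theorem eq_of_mem_range {f : ℕ → ℕ} (hf : StrictMono f) {p c : ℕ} (h : ∀ i < c, f i ≤ p)
    (h' : p < f c) (hm : p + 1 ∈ Set.range f) : f c = p + 1 := by
  by_contra hne
  exact not_mem_range_of_lt hf h (by omega) hm

/-- In the invariant, `c` counts the marks of `f` met so far and `v` is the position of the last
mark kept (0 at the start). The next mark to keep is `f v`, since `g (s + 1) = f (g s)`, so `d = v -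
c` marks must go first. -/
theorem wp_scan {f g : ℕ → ℕ} (hfg : IsOrbit f g) {R : ℕ} {σ : Store} (hcell : σ.reg .cell = 0)
    (hr : σ.reg .r = R) (hd : σ.reg .d = 0) (hu : σ.reg .u = 0) (hs : σ.reg .s = 0)
    (hβ : Table f R σ.bits) :
    wp scan (fun σ' N => (∃ c v, ScanInv f g R σ σ' R c v) ∧ σ'.reg .r = 0 ∧
      N ≤ 18 * R + 1) σ := by
  have hg := hfg.orbit_strictMono
  -- Emptying `u` costs 5 per unit, and this is saved up, as 5 per unit of `u`, while the cells
  -- between kept marks are treated.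
  refine (wp_loop (fun τ φ => (∃ p c v, ScanInv f g R σ τ p c v) ∧
    φ = 18 * τ.reg .r + 5 * τ.reg .u) (φ := 18 * R) ⟨⟨0, 0, 0, ?_⟩, by simp [hr, hu]⟩ ?_).mono ?_
  · constructor <;> try simp [hcell, hr, hd, hu, hs, hfg.apply_zero, hfg.zero]
    · intro i h1 h2; omega
    · intro i h1 h2; simpa using hβ i h1 h2
  · rintro τ _ ⟨⟨p, c, v, h⟩, rfl⟩ ht
    have hr' : 0 < τ.reg .r := by simpa [Test.eval] using ht
    have h1 := h.cell
    have h2 := h.r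
    have h3 := h.d
    have h4 := h.u
    have hcv : f c ≤ f v := hfg.strictMono.monotone (by omega)
    have hor := h.orbit
    have hlf := h.lt_f
    have htf := h.table_f (p + 1) (by omega) (by omega)
    refine wp_seq (wp_op (wp_seq (wp_op (wp_ite (fun hm => wp_ite (fun hd => ?_) (fun hd => ?_))
      (fun hm => ?_)))))
    · simp [Test.eval, Op.apply, h1] at hm hd
      have hc := eq_of_mem_range hfg.strictMono h.f_le h.lt_f (htf.1 hm)
      have hgs : p + 1 < g (τ.reg .s) := by
        rw [hor, ← hc]
        exact hfg.strictMono (by omega)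
      refine wp_seq (wp_op (wp_seq (wp_op (wp_op ⟨_, ⟨⟨p + 1, c + 1, v, ?_⟩, rfl⟩, ?_⟩))))
      · constructor <;> try simp [Op.apply, h1, h.k, h.n, h.err]
        · omega
        · omega
        · omega
        · exact hor
        · rw [← hc]; exact hfg.strictMono (by omega)
        · intro i hi
          rw [← hc]; exact hfg.strictMono.monotone (by omega)
        · exact hgs
        · intro i hi; exact (h.g_le i hi).trans (by omega)
        · intro i hi0 hi
          rcases Nat.lt_or_ge p i with hpi | hpi
          · obtain rfl : i = p + 1 := by omega
            simpa using not_mem_range_of_lt hg h.g_le hgs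
          · rw [Function.update_of_ne (by omega)]
            exact h.table_g i hi0 hpi
        · intro i hpi hi
          rw [Function.update_of_ne (by omega)]
          simpa using h.table_f i (by omega) hi
      · simp [Op.apply]
        omega
    · simp [Test.eval, Op.apply, h1] at hm hd
      have hc := eq_of_mem_range hfg.strictMono h.f_le h.lt_f (htf.1 hm)
      obtain rfl : c = v := by omega
      have hgs : g (τ.reg .s) = p + 1 := hor.trans hc
      refine wp_seq (wp_op ((wp_transfer (by decide) _).mono ?_))
      rintro _ N ⟨rfl, hN⟩
      -- The cell `p + 1` is kept and becomes the new `v`. The new `d` is (p + 1) - (c + 1) = p - v,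
      -- the old `u`; hence the transfer of `u` to `d`.
      refine ⟨_, ⟨⟨p + 1, c + 1, p + 1, ?_⟩, rfl⟩, ?_⟩
      · constructor <;> try simp [Op.apply, h1, h.k, h.n, h.err]
        · omega
        · omega
        · rw [hfg.succ, hgs]
        · rw [← hc]; exact hfg.strictMono (by omega)
        · intro i hi
          rw [← hc]; exact hfg.strictMono.monotone (by omega)
        · rw [← hgs]; exact hg (by omega)
        · intro i hi
          rw [← hgs]; exact hg.monotone (by omega)
        · intro i hi0 hi
          rcases Nat.lt_or_ge p i with hpi | hpi
          · obtain rfl : i = p + 1 := by omega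
            exact iff_of_true hm ⟨_, hgs⟩
          · exact h.table_g i hi0 hpi
        · intro i hpi hi
          simpa using h.table_f i (by omega) hi
      · simp [Op.apply] at hN ⊢
        omega
    · simp [Test.eval, Op.apply, h1] at hm
      have hc : p + 1 < f c := by
        by_contra hcon
        have : f c = p + 1 := by omega
        simp [htf.2 ⟨c, this⟩] at hm
      have hgs : p + 1 < g (τ.reg .s) := by omega
      refine wp_op ⟨_, ⟨⟨p + 1, c, v, ?_⟩, rfl⟩, ?_⟩
      · constructor <;> try simp [Op.apply, h1, h.k, h.n, h.err]
        · omega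
        · omega
        · omega
        · exact hor
        · exact hc
        · intro i hi; exact (h.f_le i hi).trans (by omega)
        · exact hgs
        · intro i hi; exact (h.g_le i hi).trans (by omega)
        · intro i hi0 hi
          rcases Nat.lt_or_ge p i with hpi | hpi
          · obtain rfl : i = p + 1 := by omega
            simpa [hm] using not_mem_range_of_lt hg h.g_le hgs
          · exact h.table_g i hi0 hpi
        · intro i hpi hi
          simpa using h.table_f i (by omega) hi
      · simp [Op.apply]
        omega
  · rintro τ N ⟨_, ⟨⟨p, c, v, h⟩, rfl⟩, ht, hN⟩
    have hr' : τ.reg .r = 0 := by simpa [Test.eval] using ht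
    have := h.r
    obtain rfl : p = R := by omega
    exact ⟨⟨c, v, h⟩, hr', by omega⟩

/-! ### Descending the Ackermann hierarchy -/

/-- Pass from the bitmap of `f` to that of its orbit `g`, and from an argument `g q` of `f` to the
argument `q + 1` of `g`; record an error if the argument of `f` is not a value of `g`. -/
def descend : Prog :=
  .seq (.op (.dec .k)) <| .seq scan <|
  .seq (.ite .marked (.done true) (.seq (.op (.inc .err)) (clear .s))) <|
  .seq (clear .cell) <| .seq (clear .d) <| .seq (clear .u) (transfer .s .r)

/-- The auxiliary counters are zero. -/
structure Rest (σ : Store) : Prop where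
  cell : σ.reg .cell = 0
  d : σ.reg .d = 0
  u : σ.reg .u = 0
  s : σ.reg .s = 0

theorem IsOrbit.lt_orbit {f g : ℕ → ℕ} (h : IsOrbit f g) (n : ℕ) : n < g n := by
  induction n with
  | zero => simp [h.zero]
  | succ n ih =>
    rw [h.succ]
    have := h.lt_apply (g n)
    omega

/-- After the scan the head is at `R`, so testing its cell decides whether `R` is a value of `g`;
the origin counts as marked to cover `R = 0`. The counter `s` holds the number of values of `g` up
to `R`, which for `R = g q` is the new argument `q + 1`. -/
theorem wp_descend {f g : ℕ → ℕ} (hfg : IsOrbit f g) {R : ℕ} {σ : Store} (h : Rest σ)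
    (hr : σ.reg .r = R) (hβ : Table f R σ.bits) :
    wp descend (fun σ' N => Rest σ' ∧ σ'.reg .k = σ.reg .k - 1 ∧ σ'.reg .n = σ.reg .n ∧
      N ≤ 35 * R + 20 ∧ Table g (σ'.reg .r) σ'.bits ∧
      ((R = 0 ∧ σ'.reg .r = 0 ∧ σ'.reg .err = σ.reg .err) ∨
        (∃ q, R = g q ∧ σ'.reg .r = q + 1 ∧ σ'.reg .err = σ.reg .err) ∨
        (R ≠ 0 ∧ R ∉ Set.range g ∧ σ'.reg .r = 0 ∧ σ'.reg .err = σ.reg .err + 1))) σ := by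
  have hg := hfg.orbit_strictMono
  refine wp_seq (wp_op (wp_seq ((wp_scan hfg (R := R) ?_ ?_ ?_ ?_ ?_ ?_).mono ?_)))
  · simpa [Op.apply] using h.cell
  · simpa [Op.apply] using hr
  · simpa [Op.apply] using h.d
  · simpa [Op.apply] using h.u
  · simpa [Op.apply] using h.s
  · simpa [Op.apply] using hβ
  rintro τ N₁ ⟨⟨c, v, hi⟩, hr0, hN₁⟩
  have hk := hi.k
  have hn := hi.n
  have he := hi.err
  have hcell := hi.cell
  have hd : τ.reg .d ≤ R := by have := hi.d; have := hi.u; omega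
  have hu : τ.reg .u ≤ R := by have := hi.u; omega
  have hs : τ.reg .s ≤ R := by
    by_contra hcon
    have := hi.g_le R (by omega)
    have := hfg.lt_orbit R
    omega
  simp [Op.apply] at hk hn he
  have hm : Test.marked.eval τ = true ↔ R = 0 ∨ R ∈ Set.range g := by
    rcases Nat.eq_zero_or_pos R with h0 | h0
    · simp [Test.eval, hcell, h0]
    · rw [← hi.table_g R h0 le_rfl]
      simp [Test.eval, hcell]
  refine wp_seq (wp_ite (fun ht => wp_done ?_) (fun ht => wp_seq (wp_op
    ((wp_clear _ _).mono ?_))))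
  · refine wp_seq ((wp_clear _ _).mono ?_)
    rintro _ N₂ ⟨rfl, hN₂⟩
    refine wp_seq ((wp_clear _ _).mono ?_)
    rintro _ N₃ ⟨rfl, hN₃⟩
    refine wp_seq ((wp_clear _ _).mono ?_)
    rintro _ N₄ ⟨rfl, hN₄⟩
    refine (wp_transfer (by decide) _).mono ?_
    rintro _ N₅ ⟨rfl, hN₅⟩
    simp [hcell] at hN₂ hN₃ hN₄ hN₅
    refine ⟨⟨?_, ?_, ?_, ?_⟩, ?_, ?_, ?_, ?_, ?_⟩
    · simp
    · simp
    · simp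
    · simp
    · simp [hk]
    · simp [hn]
    · omega
    · simp only [Function.update_self]
      intro i h0 hi'
      refine hi.table_g i h0 (hi'.trans ?_)
      simp [hr0, hs]
    · rcases hm.1 ht with h0 | ⟨q, hq⟩
      · refine Or.inl ⟨h0, ?_, ?_⟩
        · simp [hr0]; omega
        · simp [he]
      · refine Or.inr (Or.inl ⟨q, hq.symm, ?_, ?_⟩)
        · simp [hr0]
          -- The values of `g` up to `R = g q` are those at 0, …, q, so `s` is neither smaller nor
          -- larger than `q + 1`.
          have h1 : q < τ.reg .s := hg.lt_iff_lt.1 (by rw [hq]; exact hi.lt_g)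
          by_contra hcon
          have := hi.g_le (q + 1) (by omega)
          have : g q < g (q + 1) := hg (by omega)
          omega
        · simp [he]
  · rintro _ N₀ ⟨rfl, hN₀⟩
    refine wp_seq ((wp_clear _ _).mono ?_)
    rintro _ N₂ ⟨rfl, hN₂⟩
    refine wp_seq ((wp_clear _ _).mono ?_)
    rintro _ N₃ ⟨rfl, hN₃⟩
    refine wp_seq ((wp_clear _ _).mono ?_)
    rintro _ N₄ ⟨rfl, hN₄⟩
    refine (wp_transfer (by decide) _).mono ?_
    rintro _ N₅ ⟨rfl, hN₅⟩
    simp [hcell, Op.apply] at hN₀ hN₂ hN₃ hN₄ hN₅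
    have hm' : ¬ (R = 0 ∨ R ∈ Set.range g) := by rw [← hm, ht]; simp
    refine ⟨⟨?_, ?_, ?_, ?_⟩, ?_, ?_, ?_, ?_, Or.inr (Or.inr ⟨?_, ?_, ?_, ?_⟩)⟩
    · simp
    · simp
    · simp
    · simp
    · simp [hk, Op.apply]
    · simp [hn, Op.apply]
    · omega
    · simp only [Function.update_self]
      intro i h0 hi'
      simp [hr0, Op.apply] at hi'
      omega
    · exact fun h => hm' (Or.inl h)
    · exact fun h => hm' (Or.inr h)
    · simp [hr0, Op.apply]
    · simp [he, Op.apply]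

/-- The factor 3/4 by which arguments shrink in the descent is attained at q = 2. The values 1 and 2
have to be excluded: they lead to the arguments 1 and 2 again. -/
theorem four_mul_succ_le {q : ℕ} (hq : 3 ≤ 2 ^ q) : 4 * (q + 1) ≤ 3 * 2 ^ q := by
  have h2 : 2 ≤ q := by
    by_contra hcon
    have : q = 0 ∨ q = 1 := by omega
    rcases this with rfl | rfl <;> simp at hq
  clear hq
  induction q, h2 using Nat.le_induction with
  | base => norm_num
  | succ q h ih => rw [pow_succ]; omega

theorem four_mul_succ_le_ackA {k q : ℕ} (hq : 3 ≤ ackA k q) : 4 * (q + 1) ≤ 3 * ackA k q := by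
  have h1 := two_pow_le_ackA k q
  by_cases h : 3 ≤ 2 ^ q
  · exact (four_mul_succ_le h).trans (by omega)
  · have : q = 0 ∨ q = 1 := by
      by_contra hcon
      have : 2 ^ 2 ≤ 2 ^ q := Nat.pow_le_pow_right (by norm_num) (by omega)
      omega
    rcases this with rfl | rfl
    · rw [ackA_zero_right] at hq; omega
    · rw [ackA_one] at hq; omega

/-- The invariant of the main loop at level `i`: either the question is still whether the `r`-th
value of level `i` is `2 ^ x`, or it has been found that `2 ^ x` is not a value at level `K`. -/
structure MainInv (K A x E : ℕ) (σ : Store) (i : ℕ) : Prop where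
  rest : Rest σ
  k : i + σ.reg .k = K
  n : σ.reg .n = A
  table : Table (ackA i) (σ.reg .r) σ.bits
  value : (ackA i (σ.reg .r) = 2 ^ x ∧ σ.reg .err = E) ∨
    (σ.reg .r = 0 ∧ 0 < σ.reg .err ∧ 2 ^ x ∉ Set.range (ackA K))

/-- For `r ≥ 3` the loss of a quarter of `r`, at weight 140, pays the `35 * r` of a pass. For `r ≤
2` the level pays everything: 92 = 35 · 2 + 20 + 2. -/
theorem wp_main {K A x E : ℕ} {σ : Store} (h : MainInv K A x E σ 0) :
    wp (.loop (.pos .k) descend) (fun σ' N => MainInv K A x E σ' K ∧ σ'.reg .r ≤ σ.reg .r ∧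
      N ≤ 92 * K + 140 * σ.reg .r + 1) σ := by
  refine (wp_loop (fun τ φ => (∃ i, MainInv K A x E τ i) ∧ τ.reg .r ≤ σ.reg .r ∧
    φ = 92 * τ.reg .k + 140 * τ.reg .r) ⟨⟨0, h⟩, le_rfl, rfl⟩ ?_).mono ?_
  · rintro τ _ ⟨⟨i, hi⟩, hle, rfl⟩ ht
    have hk : 0 < τ.reg .k := by simpa [Test.eval] using ht
    have hiK := hi.k
    refine (wp_descend (isOrbit_ackA i) hi.rest rfl hi.table).mono ?_
    rintro τ' N ⟨h1, h2, h3, h4, h5, h6⟩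
    have key : MainInv K A x E τ' (i + 1) := by
      refine ⟨h1, by clear h6; omega, h3.trans hi.n, h5, ?_⟩
      rcases h6 with ⟨h0, h7, h8⟩ | ⟨q, h0, h7, h8⟩ | ⟨h0, h0', h7, h8⟩
      · rcases hi.value with ⟨h9, h10⟩ | ⟨_, h9, h10⟩
        · left
          rw [h0, ackA_zero_right] at h9
          rw [h7, ackA_zero_right]
          exact ⟨h9, h8.trans h10⟩
        · exact Or.inr ⟨h7, h8 ▸ h9, h10⟩
      · rcases hi.value with ⟨h9, h10⟩ | ⟨h9, _, _⟩
        · left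
          rw [h7, ackA_succ_succ, ← h0]
          exact ⟨h9, h8.trans h10⟩
        · have := (isOrbit_ackA i).lt_orbit q
          omega
      · right
        refine ⟨h7, by omega, ?_⟩
        rcases hi.value with ⟨h9, h10⟩ | ⟨h9, _, _⟩
        · rw [← h9]
          exact ackA_not_mem_range (by omega) h0 h0'
        · exact absurd h9 h0
    refine ⟨_, ⟨⟨i + 1, key⟩, ?_, rfl⟩, ?_⟩
    · rcases h6 with ⟨h0, h7, h8⟩ | ⟨q, h0, h7, h8⟩ | ⟨h0, h0', h7, h8⟩
      · omega
      · have := (isOrbit_ackA i).lt_orbit q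
        omega
      · omega
    · rcases h6 with ⟨h0, h7, h8⟩ | ⟨q, h0, h7, h8⟩ | ⟨h0, h0', h7, h8⟩
      · omega
      · have := (isOrbit_ackA i).lt_orbit q
        rw [h7, h2]
        by_cases h9 : 3 ≤ τ.reg .r
        · have := four_mul_succ_le_ackA (k := i + 1) (q := q) (by omega)
          omega
        · omega
      · omega
  · rintro τ N ⟨_, ⟨⟨i, hi⟩, hle, rfl⟩, ht, hN⟩
    have hk : τ.reg .k = 0 := by simpa [Test.eval] using ht
    have h1 := hi.k
    have h2 := h.k
    obtain rfl : i = K := by omega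
    exact ⟨hi, hle, by omega⟩

/-- Record an error if the counters `r` and `n` differ. -/
def compare : Prog :=
  .seq (.loop (.pos .r) (.seq (.op (.dec .r)) (.ite (.pos .n) (.op (.dec .n)) (.op (.inc .err)))))
    (transfer .n .err)

theorem wp_compare (σ : Store) :
    wp compare (fun σ' N => (σ'.reg .err = 0 ↔ σ.reg .err = 0 ∧ σ.reg .r = σ.reg .n) ∧
      N ≤ 6 * σ.reg .r + 5 * σ.reg .n + 4) σ := by
  -- The truth of "no error and `r = n`" is invariant: both counters drop together, and if `n` runs
  -- out first an error replaces the inequality. What is left of `n` at the end becomes an error.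
  refine wp_seq ((wp_loop (fun τ φ => (τ.reg .err = 0 ∧ τ.reg .r = τ.reg .n ↔
      σ.reg .err = 0 ∧ σ.reg .r = σ.reg .n) ∧ τ.reg .n ≤ σ.reg .n ∧
      φ = 6 * τ.reg .r) ⟨Iff.rfl, le_rfl, rfl⟩ ?_).mono ?_)
  · rintro τ _ ⟨h1, h2, rfl⟩ ht
    have hr : 0 < τ.reg .r := by simpa [Test.eval] using ht
    refine wp_seq (wp_op (wp_ite (fun hn => wp_op ⟨_, ⟨?_, ?_, rfl⟩, ?_⟩)
      (fun hn => wp_op ⟨_, ⟨?_, ?_, rfl⟩, ?_⟩)))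
    · simp [Op.apply, Test.eval] at hn ⊢
      rw [← h1]
      omega
    · simp [Op.apply]
      omega
    · simp [Op.apply]
      omega
    · simp [Op.apply, Test.eval] at hn ⊢
      omega
    · simp [Op.apply]
      omega
    · simp [Op.apply]
      omega
  · rintro τ N ⟨_, ⟨h1, h2, rfl⟩, ht, hN⟩
    have hr : τ.reg .r = 0 := by simpa [Test.eval] using ht
    refine (wp_transfer (by decide) _).mono ?_
    rintro _ N' ⟨rfl, hN'⟩
    refine ⟨?_, by omega⟩
    rw [← h1]
    simp [hr]
    omega

/-! ### Reading the input -/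

theorem mk₂_move_right (l r : List Sym) (a : Sym) :
    (Tape.mk₂ l (a :: r)).move .right = Tape.mk₂ (a :: l) r := by
  rw [Tape.mk₂, Tape.move_right_mk']
  rfl

theorem mk₂_move_left (l r : List Sym) (a : Sym) :
    (Tape.mk₂ (a :: l) r).move .left = Tape.mk₂ l (a :: r) := by
  rw [Tape.mk₂, Tape.move_left_mk']
  rfl

theorem mk₂_head_cons (l r : List Sym) (a : Sym) : (Tape.mk₂ l (a :: r)).head = a := rfl

theorem mk₂_head_nil (l : List Sym) : (Tape.mk₂ l []).head = none := rfl

/-- The symbol is a binary digit. -/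
def isDigit : Sym → Bool
  | some (.digit _) => true
  | _ => false

/-- The symbol is the binary digit `1`. -/
def isOne : Sym → Bool
  | some (.digit b) => b
  | _ => false

/-- A string of binary digits, as tape symbols. -/
def digits (l : List Bool) : List Sym := l.map fun b => some (.digit b)

/-- Store the length of the input in `capK`, `capN` and `tmp`, moving to the end of the input. -/
def measure : Prog :=
  .loop (.symbol Option.isSome) <|
    .seq (.op (.inc .capK)) <| .seq (.op (.inc .capN)) <| .seq (.op (.inc .tmp)) <|
      .op (.move .right)

/-- Move to the left as many times as the counter `tmp` says. -/
def rewind : Prog := .loop (.pos .tmp) <| .seq (.op (.dec .tmp)) (.op (.move .left))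

/-- The store after the length `L` of the input has been determined. -/
structure Measured (w : List InputSymbol) (σ : Store) : Prop where
  input : σ.input = Tape.mk₂ [] (w.map some)
  bits : ∀ i, σ.bits i = false
  capK : σ.reg .capK = w.length
  capN : σ.reg .capN = w.length
  reg : ∀ x, x ≠ .capK → x ≠ .capN → σ.reg x = 0

theorem wp_measure_rewind (w : List InputSymbol) :
    wp (.seq measure rewind) (fun σ N => Measured w σ ∧ N ≤ 14 * w.length + 3)
      (Store.init w) := by
  refine wp_seq ((wp_loop (fun τ φ => ∃ l r, l.reverse ++ r = w ∧
    τ.input = Tape.mk₂ (l.map some) (r.map some) ∧ (∀ i, τ.bits i = false) ∧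
    τ.reg .capK = l.length ∧ τ.reg .capN = l.length ∧ τ.reg .tmp = l.length ∧
    (∀ x, x ≠ .capK → x ≠ .capN → x ≠ .tmp → τ.reg x = 0) ∧ φ = 9 * r.length)
    (φ := 9 * w.length) ⟨[], w, by simp, rfl, fun _ => rfl, rfl, rfl, rfl, fun _ _ _ _ => rfl, rfl⟩
    ?_).mono ?_)
  · rintro τ _ ⟨l, r, hw, h1, h2, h3, h4, h5, h6, rfl⟩ ht
    cases r with
    | nil => simp [Test.eval, h1, mk₂_head_nil] at ht
    | cons a r =>
      refine wp_seq (wp_op (wp_seq (wp_op (wp_seq (wp_op (wp_op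
        ⟨_, ⟨a :: l, r, by simpa using hw, ?_, ?_, ?_, ?_, ?_, ?_, rfl⟩, ?_⟩))))))
      · simp [Op.apply, h1, mk₂_move_right]
      · simpa [Op.apply] using h2
      · simp [Op.apply, h3]
      · simp [Op.apply, h4]
      · simp [Op.apply, h5]
      · intro x hx hx' hx''
        simp [Op.apply, hx, hx', hx'', h6]
      · simp
        omega
  · rintro τ N ⟨_, ⟨l, r, hw, h1, h2, h3, h4, h5, h6, rfl⟩, ht, hN⟩
    cases r with
    | cons a r => simp [Test.eval, h1, mk₂_head_cons] at ht
    | nil =>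
    have hlen : l.length = w.length := by rw [← hw]; simp
    refine (wp_loop (fun υ φ => ∃ l r, l.reverse ++ r = w ∧
      υ.input = Tape.mk₂ (l.map some) (r.map some) ∧ (∀ i, υ.bits i = false) ∧
      υ.reg .capK = w.length ∧ υ.reg .capN = w.length ∧ υ.reg .tmp = l.length ∧
      (∀ x, x ≠ .capK → x ≠ .capN → x ≠ .tmp → υ.reg x = 0) ∧ φ = 5 * l.length)
      (φ := 5 * w.length) ⟨l, [], hw, h1, h2, h3.trans hlen, h4.trans hlen, h5, h6, by rw [hlen]⟩
      ?_).mono ?_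
    · rintro υ _ ⟨l, r, hw, h1, h2, h3, h4, h5, h6, rfl⟩ ht
      cases l with
      | nil => simp [Test.eval, h5] at ht
      | cons a l =>
        refine wp_seq (wp_op (wp_op
          ⟨_, ⟨l, a :: r, by simpa using hw, ?_, ?_, ?_, ?_, ?_, ?_, rfl⟩, ?_⟩))
        · simp [Op.apply, h1, mk₂_move_left]
        · simpa [Op.apply] using h2
        · simp [Op.apply, h3]
        · simp [Op.apply, h4]
        · simp [Op.apply, h5]
        · intro x hx hx' hx''
          simp [Op.apply, hx, hx', hx'', h6]
        · simp
          omega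
    · rintro υ N' ⟨_, ⟨l, r, hw, h1, h2, h3, h4, h5, h6, rfl⟩, ht, hN'⟩
      cases l with
      | cons a l => simp [Test.eval, h5] at ht
      | nil =>
      refine ⟨⟨?_, h2, h3, h4, ?_⟩, ?_⟩
      · rw [h1, ← hw]; rfl
      · intro x hx hx'
        by_cases hx'' : x = .tmp
        · rw [hx'', h5]; rfl
        · exact h6 x hx hx' hx''
      · simp at hN
        omega

/-! ### Binary to unary conversion with saturation -/

/-- Increase the counter `c`, if the remaining capacity `cap` allows it. -/
def incCapped (c cap : Reg) : Prog :=
  .ite (.pos cap) (.seq (.op (.dec cap)) (.op (.inc c))) (.done true)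

/-- Double the counter `c`, within the remaining capacity `cap`. -/
def double (c cap : Reg) : Prog :=
  .seq (transfer c .tmp) <|
    .loop (.pos .tmp) <| .seq (.op (.dec .tmp)) <| .seq (.op (.inc c)) (incCapped c cap)

/-- Read a number in binary into the counter `c`, up to the capacity `cap`, and skip the symbol
behind it. -/
def decode (c cap : Reg) : Prog :=
  .seq (.loop (.symbol isDigit) <|
    .seq (.ite (.pos cap)
        (.seq (double c cap) (.ite (.symbol isOne) (incCapped c cap) (.done true))) (.done true)) <|
      .op (.move .right))
    (.op (.move .right))

/-- The potential that pays for the doublings of a counter with capacity `L`, of which `c` is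
left. -/
def credit (c L : ℕ) : ℕ := c + if c = 0 then 0 else L

theorem credit_zero (L : ℕ) : credit 0 L = 0 := rfl

theorem credit_of_pos {c : ℕ} (h : 0 < c) (L : ℕ) : credit c L = c + L := by
  rw [credit, if_neg h.ne']

theorem credit_le (c L : ℕ) : credit c L ≤ c + L := by
  unfold credit
  split_ifs <;> omega

/-- The stores `σ` and `τ` differ at most in the counters `c` and `cap`. -/
structure Frame (c cap : Reg) (σ τ : Store) : Prop where
  input : τ.input = σ.input
  bits : τ.bits = σ.bits
  reg : ∀ x, x ≠ c → x ≠ cap → τ.reg x = σ.reg x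

theorem wp_incCapped {c cap : Reg} (hc : c ≠ cap) (σ : Store) :
    wp (incCapped c cap) (fun τ N => Frame c cap σ τ ∧ τ.reg c = σ.reg c + min 1 (σ.reg cap) ∧
      τ.reg cap = σ.reg cap - 1 ∧ N ≤ 4) σ := by
  refine wp_ite (fun h => wp_seq (wp_op (wp_op ⟨⟨rfl, rfl, ?_⟩, ?_, ?_, by omega⟩)))
    (fun h => wp_done ⟨⟨rfl, rfl, fun _ _ _ => rfl⟩, ?_, ?_, by omega⟩)
  · intro x h1 h2
    simp [Op.apply, h1, h2]
  · simp [Op.apply, hc, Test.eval] at h ⊢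
    omega
  · simp [Op.apply, hc.symm]
  · simp [Test.eval] at h
    simp [h]
  · simp [Test.eval] at h
    simp [h]

theorem wp_double {c cap : Reg} (hc : c ≠ cap) (hc' : c ≠ .tmp) (hcap : cap ≠ .tmp) {σ : Store}
    (ht : σ.reg .tmp = 0) :
    wp (double c cap) (fun τ N => Frame c cap σ τ ∧
      τ.reg c = σ.reg c + min (σ.reg c) (σ.reg cap) ∧
      τ.reg cap = σ.reg cap - σ.reg c ∧ N ≤ 15 * σ.reg c + 3) σ := by
  refine wp_seq ((wp_transfer hc' σ).mono ?_)
  rintro _ N₁ ⟨rfl, hN₁⟩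
  refine (wp_loop (fun τ φ => ∃ a b, a + b = σ.reg c ∧ τ.input = σ.input ∧ τ.bits = σ.bits ∧
    (∀ x, x ≠ c → x ≠ cap → x ≠ .tmp → τ.reg x = σ.reg x) ∧ τ.reg .tmp = a ∧
    τ.reg c = b + min b (σ.reg cap) ∧ τ.reg cap = σ.reg cap - b ∧ φ = 10 * a)
    (φ := 10 * σ.reg c) ⟨σ.reg c, 0, by simp, ?_, ?_, ?_, ?_, ?_, ?_, rfl⟩ ?_).mono ?_
  · rfl
  · rfl
  · intro x h1 h2 h3
    simp [h1, h3]
  · simp [ht]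
  · simp [hc']
  · simp [hcap, hc.symm]
  · rintro τ _ ⟨a, b, hab, h1, h2, h3, h4, h5, h6, rfl⟩ htest
    have ha : 0 < a := by simpa [Test.eval, h4] using htest
    -- The first increment restores a unit already charged to the capacity; only the second one is
    -- capped.
    refine wp_seq (wp_op (wp_seq (wp_op ((wp_incCapped hc _).mono ?_))))
    rintro υ N ⟨⟨g1, g2, g3⟩, g4, g5, hN⟩
    refine ⟨_, ⟨a - 1, b + 1, by omega, g1.trans h1, g2.trans h2, ?_, ?_, ?_, ?_, rfl⟩, by omega⟩
    · intro x hx hx' hx''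
      rw [g3 x hx hx']
      simp [Op.apply, hx, hx'', h3 x hx hx' hx'']
    · rw [g3 _ hc'.symm hcap.symm]
      simp [Op.apply, hc'.symm, h4]
    · rw [g4]
      simp [Op.apply, hc', hc.symm, hcap, h5, h6]
      omega
    · rw [g5]
      simp [Op.apply, hc.symm, hcap, h6]
      omega
  · rintro τ N ⟨_, ⟨a, b, hab, h1, h2, h3, h4, h5, h6, rfl⟩, htest, hN⟩
    have ha : a = 0 := by simpa [Test.eval, h4] using htest
    subst ha
    obtain rfl : b = σ.reg c := by omega
    refine ⟨⟨h1, h2, ?_⟩, h5, h6, by omega⟩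
    intro x hx hx'
    by_cases hx'' : x = .tmp
    · rw [hx'', h4, ht]
    · exact h3 x hx hx' hx''

/-- A doubling that leaves capacity uses up as much of it as it costs, up to a constant factor. The
doubling that exhausts the capacity costs at most a multiple of `L`, once, and later digits are
merely skipped. -/
theorem wp_decode {c cap : Reg} (hc : c ≠ cap) (hc' : c ≠ .tmp) (hcap : cap ≠ .tmp) {σ : Store}
    (ht : σ.reg .tmp = 0) (h0 : σ.reg c = 0) {l r : List Sym} {ds : List Bool}
    (hi : σ.input = Tape.mk₂ l (digits ds ++ some .sep :: r)) :
    wp (decode c cap) (fun τ N => (∃ l', τ.input = Tape.mk₂ l' r) ∧ τ.bits = σ.bits ∧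
      (∀ x, x ≠ c → x ≠ cap → τ.reg x = σ.reg x) ∧
      τ.reg c = min (appendDigits 0 ds) (σ.reg cap) ∧
      N ≤ 20 * ds.length + 30 * σ.reg cap + 3) σ := by
  set L := σ.reg cap with hL
  refine wp_seq ((wp_loop (fun τ φ => ∃ l' ds' a, τ.input =
      Tape.mk₂ l' (digits ds' ++ some .sep :: r) ∧ τ.bits = σ.bits ∧
      (∀ x, x ≠ c → x ≠ cap → τ.reg x = σ.reg x) ∧ appendDigits a ds' = appendDigits 0 ds ∧
      τ.reg c = min a L ∧ τ.reg c + τ.reg cap = L ∧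
      φ = 20 * ds'.length + 15 * credit (τ.reg cap) L)
    ⟨l, ds, 0, hi, rfl, fun _ _ _ => rfl, rfl, by simp [h0], by omega, rfl⟩ ?_).mono ?_)
  · rintro τ _ ⟨l', ds', a, h1, h2, h3, h4, h5, h6, rfl⟩ htest
    cases ds' with
    | nil => simp [Test.eval, h1, digits, mk₂_head_cons, isDigit] at htest
    | cons b ds' =>
    have hinput : τ.input = Tape.mk₂ l' (some (.digit b) :: (digits ds' ++ some .sep :: r)) := h1
    have ht' : τ.reg .tmp = 0 := by rw [h3 _ hc'.symm hcap.symm, ht]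
    refine wp_seq (wp_ite (fun hpos => ?_) (fun hpos => wp_done ?_))
    · have hpos' : 0 < τ.reg cap := by simpa [Test.eval] using hpos
      refine wp_seq ((wp_double hc hc' hcap ht').mono ?_)
      rintro υ N₁ ⟨⟨g1, g2, g3⟩, g4, g5, hN₁⟩
      have step : ∀ (υ' : Store) (N : ℕ), Frame c cap υ υ' →
          υ'.reg c = υ.reg c + min b.toNat (υ.reg cap) → υ'.reg cap = υ.reg cap - b.toNat →
          N ≤ 5 → wp (.op (.move .right)) (fun τ' N' => ∃ φ', (∃ l' ds' a, τ'.input =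
            Tape.mk₂ l' (digits ds' ++ some .sep :: r) ∧ τ'.bits = σ.bits ∧
            (∀ x, x ≠ c → x ≠ cap → τ'.reg x = σ.reg x) ∧
            appendDigits a ds' = appendDigits 0 ds ∧
            τ'.reg c = min a L ∧ τ'.reg c + τ'.reg cap = L ∧
            φ' = 20 * ds'.length + 15 * credit (τ'.reg cap) L) ∧
            φ' + (N₁ + 1 + N + 1 + 1 + N') + 2 ≤ 20 * (b :: ds').length +
              15 * credit (τ.reg cap) L) υ' := by
        rintro υ' N ⟨f1, f2, f3⟩ f4 f5 hN
        refine wp_op ⟨_, ⟨some (.digit b) :: l', ds', 2 * a + b.toNat, ?_, ?_, ?_, h4, ?_, ?_, rfl⟩,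
          ?_⟩
        · simp only [Op.apply]
          rw [f1, g1, hinput, mk₂_move_right]
        · exact f2.trans (g2.trans h2)
        · intro x hx hx'
          exact (f3 x hx hx').trans ((g3 x hx hx').trans (h3 x hx hx'))
        · simp only [Op.apply]
          omega
        · simp only [Op.apply]
          cases b <;> simp at f4 f5 <;> omega
        · simp only [Op.apply, List.length_cons]
          rw [credit_of_pos hpos' L]
          -- If the capacity has just run out, the lump `L` in `credit` is released and pays for
          -- this doubling.
          rcases Nat.eq_zero_or_pos (υ'.reg cap) with hz | hz
          · rw [hz, credit_zero]
            omega
          · rw [credit_of_pos hz L]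
            cases b <;> simp at f4 f5 <;> omega
      refine wp_ite (fun hone => (wp_incCapped hc υ).mono ?_) (fun hone => wp_done ?_)
      · rintro υ' N ⟨f1, f2, f3, hN⟩
        have hb : b = true := by
          simpa [Test.eval, g1, hinput, mk₂_head_cons, isOne] using hone
        subst hb
        exact step υ' (N + 1) f1 f2 f3 (by omega)
      · have hb : b = false := by
          simpa [Test.eval, g1, hinput, mk₂_head_cons, isOne] using hone
        subst hb
        exact step υ 1 ⟨rfl, rfl, fun _ _ _ => rfl⟩ (by simp) (by simp) (by omega)
    · have hpos' : τ.reg cap = 0 := by simpa [Test.eval] using hpos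
      refine wp_op ⟨_, ⟨some (.digit b) :: l', ds', 2 * a + b.toNat, ?_, h2, h3, h4, ?_, h6, rfl⟩,
        ?_⟩
      · simp only [Op.apply]
        rw [hinput, mk₂_move_right]
      · simp only [Op.apply]
        omega
      · simp only [Op.apply, List.length_cons]
        rw [hpos', credit_zero]
        omega
  · rintro τ N ⟨_, ⟨l', ds', a, h1, h2, h3, h4, h5, h6, rfl⟩, htest, hN⟩
    cases ds' with
    | cons b ds' => simp [Test.eval, h1, digits, mk₂_head_cons, isDigit] at htest
    | nil =>
    refine wp_op ⟨⟨some .sep :: l', ?_⟩, h2, h3, ?_, ?_⟩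
    · simp [Op.apply, h1, digits, mk₂_move_right]
    · rw [← h4]
      exact h5
    · have := credit_le (σ.reg cap) L
      simp at hN
      omega

/-- Read the last number of the input, and record an error if its digits are not a one followed by
zeros. For each digit after the first one, a cell of the bitmap of `dbl` is written. -/
def readPow : Prog :=
  .seq (.ite (.symbol isOne) (.done true) (.op (.inc .err))) <|
  .seq (.op (.move .right)) <|
  .seq (.op (.inc .cell)) <| .seq (.op (.mark true)) <| .seq (.op (.dec .cell)) <|
  .loop (.symbol Option.isSome) <|
    .seq (.ite (.symbol isOne) (.op (.inc .err)) (.done true)) <|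
    .seq (.op (.move .right)) <| .seq (.op (.inc .cell)) <|
      .ite (.pos .tmp) (.seq (.op (.mark true)) (.op (.dec .tmp))) (.op (.inc .tmp))

/-- The invariant of the loop in `readPow`, when `ds` remains to be read. -/
structure ReadInv (σ₀ : Store) (x : ℕ) (G : Prop) (σ : Store) (ds : List Bool) : Prop where
  input : ∃ l, σ.input = Tape.mk₂ l (digits ds)
  cell : σ.reg .cell + ds.length = x
  tmp : σ.reg .tmp = σ.reg .cell % 2
  bits : ∀ i, 0 < i → (σ.bits i = true ↔ i = 1 ∨ (i % 2 = 0 ∧ i ≤ σ.reg .cell))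
  err : (σ.reg .err = 0 ∧ ∀ b ∈ ds, b = false) ↔ G
  reg : ∀ y, y ≠ .cell → y ≠ .tmp → y ≠ .err → σ.reg y = σ₀.reg y

/-- Since `tmp` is the parity of the old head position, a mark is written exactly when the new
position is even. Cell 1, the value of `dbl` at 0, was marked beforehand. -/
theorem ReadInv.read {σ₀ : Store} {x : ℕ} {G : Prop} {σ τ : Store} {b : Bool} {ds : List Bool}
    (h : ReadInv σ₀ x G σ (b :: ds)) (hinput : τ.input = σ.input.move .right)
    (hcell : τ.reg .cell = σ.reg .cell + 1) (htmp : τ.reg .tmp = 1 - σ.reg .tmp)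
    (hbits : τ.bits = if 0 < σ.reg .tmp then Function.update σ.bits (σ.reg .cell + 1) true
      else σ.bits)
    (herr : τ.reg .err = σ.reg .err + b.toNat)
    (hreg : ∀ y, y ≠ .cell → y ≠ .tmp → y ≠ .err → τ.reg y = σ.reg y) :
    ReadInv σ₀ x G τ ds := by
  have h1 := h.tmp
  refine ⟨?_, ?_, ?_, ?_, ?_, fun y hy hy' hy'' => (hreg y hy hy' hy'').trans (h.reg y hy hy' hy'')⟩
  · obtain ⟨l, hl⟩ := h.input
    exact ⟨some (.digit b) :: l, by rw [hinput, hl]; exact mk₂_move_right _ _ _⟩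
  · have := h.cell
    simp at this
    omega
  · omega
  · intro i hi
    have hb := h.bits i hi
    rw [hbits, hcell]
    split_ifs with h2
    · by_cases h3 : i = σ.reg .cell + 1
      · subst h3
        simp
        omega
      · rw [Function.update_of_ne h3, hb]
        omega
    · rw [hb]
      omega
  · rw [← h.err, herr]
    cases b <;> simp

theorem wp_readPow {σ : Store} {l : List Sym} {b : Bool} {ds : List Bool}
    (hi : σ.input = Tape.mk₂ l (digits (b :: ds))) (hcell : σ.reg .cell = 0)
    (htmp : σ.reg .tmp = 0) (herr : σ.reg .err = 0) (hbits : ∀ i, σ.bits i = false) :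
    wp readPow (fun τ N => τ.reg .cell = ds.length ∧ Table dbl ds.length τ.bits ∧
      (τ.reg .err = 0 ↔ b = true ∧ ∀ b ∈ ds, b = false) ∧
      (∀ y, y ≠ .cell → y ≠ .tmp → y ≠ .err → τ.reg y = σ.reg y) ∧
      N ≤ 14 * ds.length + 13) σ := by
  have hhead : σ.input.head = some (.digit b) := by rw [hi]; rfl
  -- Common continuation of both outcomes of the test on the leading digit, where `N` is the cost of
  -- that test.
  have main : ∀ (τ : Store) (N : ℕ), N ≤ 2 → τ.input = σ.input → τ.bits = σ.bits →
      τ.reg .cell = 0 → τ.reg .tmp = 0 → (τ.reg .err = 0 ↔ b = true) →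
      (∀ y, y ≠ .err → τ.reg y = σ.reg y) →
      wp (.seq (.op (.move .right)) <|
        .seq (.op (.inc .cell)) <| .seq (.op (.mark true)) <| .seq (.op (.dec .cell)) <|
        .loop (.symbol Option.isSome) <|
          .seq (.ite (.symbol isOne) (.op (.inc .err)) (.done true)) <|
          .seq (.op (.move .right)) <| .seq (.op (.inc .cell)) <|
            .ite (.pos .tmp) (.seq (.op (.mark true)) (.op (.dec .tmp))) (.op (.inc .tmp)))
        (fun τ' N' => τ'.reg .cell = ds.length ∧ Table dbl ds.length τ'.bits ∧
          (τ'.reg .err = 0 ↔ b = true ∧ ∀ b ∈ ds, b = false) ∧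
          (∀ y, y ≠ .cell → y ≠ .tmp → y ≠ .err → τ'.reg y = σ.reg y) ∧
          N + 1 + N' ≤ 14 * ds.length + 13) τ := by
    intro τ N hN h1 h2 h3 h4 h5 h6
    refine wp_seq (wp_op (wp_seq (wp_op (wp_seq (wp_op (wp_seq (wp_op ((wp_loop
      (fun υ φ => ∃ ds', ReadInv σ ds.length (b = true ∧ ∀ b ∈ ds, b = false) υ ds' ∧
        φ = 14 * ds'.length) ⟨ds, ?_, rfl⟩ ?_).mono ?_))))))))
    · refine ⟨⟨some (.digit b) :: l, ?_⟩, ?_, ?_, ?_, ?_, ?_⟩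
      · simp only [Op.apply]
        rw [h1, hi]
        exact mk₂_move_right _ _ _
      · simp [Op.apply, h3]
      · simp [Op.apply, h3, h4]
      · intro i hi
        simp [Op.apply, h3, h2]
        by_cases hi1 : i = 1
        · simp [hi1]
        · simp [hi1, hbits]
          omega
      · simp [Op.apply, h5]
      · intro y hy hy' hy''
        simp [Op.apply, h6 y hy'']
    · rintro υ _ ⟨ds', h, rfl⟩ htest
      obtain ⟨l', hl'⟩ := h.input
      cases ds' with
      | nil => simp [Test.eval, hl', digits, mk₂_head_nil] at htest
      | cons b' ds' =>
      have hhead' : υ.input.head = some (.digit b') := by rw [hl']; rfl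
      have htmp := h.tmp
      refine wp_seq (wp_ite (fun h1 => wp_op ?_) (fun h1 => wp_done ?_))
      · obtain rfl : b' = true := by simpa [Test.eval, hhead', isOne] using h1
        refine wp_seq (wp_op (wp_seq (wp_op (wp_ite
          (fun h2 => wp_seq (wp_op (wp_op ⟨_, ⟨ds', h.read ?_ ?_ ?_ ?_ ?_ ?_, rfl⟩, ?_⟩)))
          (fun h2 => wp_op ⟨_, ⟨ds', h.read ?_ ?_ ?_ ?_ ?_ ?_, rfl⟩, ?_⟩)))))
        all_goals simp [Test.eval, Op.apply] at h2 ⊢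
        all_goals first | omega | skip
        · intro y hy hy' hy''; simp [hy, hy', hy'']
        · intro y hy hy' hy''; simp [hy, hy', hy'']
      · obtain rfl : b' = false := by simpa [Test.eval, hhead', isOne] using h1
        refine wp_seq (wp_op (wp_seq (wp_op (wp_ite
          (fun h2 => wp_seq (wp_op (wp_op ⟨_, ⟨ds', h.read ?_ ?_ ?_ ?_ ?_ ?_, rfl⟩, ?_⟩)))
          (fun h2 => wp_op ⟨_, ⟨ds', h.read ?_ ?_ ?_ ?_ ?_ ?_, rfl⟩, ?_⟩)))))
        all_goals simp [Test.eval, Op.apply] at h2 ⊢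
        all_goals first | omega | skip
        · intro y hy hy' hy''; simp [hy, hy']
        · intro y hy hy' hy''; simp [hy, hy']
    · rintro υ N' ⟨_, ⟨ds', h, rfl⟩, htest, hN'⟩
      obtain ⟨l', hl'⟩ := h.input
      cases ds' with
      | cons b' ds' => simp [Test.eval, hl', digits, mk₂_head_cons] at htest
      | nil =>
      have hc : υ.reg .cell = ds.length := by simpa using h.cell
      refine ⟨hc, ?_, ?_, h.reg, by omega⟩
      · intro i hi hi'
        rw [h.bits i hi, mem_range_dbl hi, hc]
        omega
      · rw [← h.err]
        simp
  refine wp_seq (wp_ite (fun h => wp_done ?_) (fun h => wp_op ?_))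
  · have hb : b = true := by simpa [Test.eval, hhead, isOne] using h
    exact main σ 1 (by omega) rfl rfl hcell htmp (by simp [hb, herr]) fun _ _ => rfl
  · have hb : b = false := by simpa [Test.eval, hhead, isOne] using h
    refine main _ 2 le_rfl rfl rfl ?_ ?_ ?_ ?_
    · simpa [Op.apply] using hcell
    · simpa [Op.apply] using htmp
    · simp [Op.apply, hb]
    · intro y hy
      simp [Op.apply, hy]

/-! ### The decision procedure -/

/-- Compute the bitmap of the powers of two from that of `dbl`, keeping the argument. -/
def prepare : Prog :=
  .seq (transfer .cell .r) <| .seq scan <| .seq (transfer .cell .r) <|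
  .seq (clear .s) <| .seq (clear .d) (clear .u)

/-- At level 0 the argument for 2^x is x itself. The scan uses up `r` but ends with the head at x,
from where the argument is recovered. -/
theorem wp_prepare {x : ℕ} {σ : Store} (hcell : σ.reg .cell = x) (hr : σ.reg .r = 0)
    (hd : σ.reg .d = 0) (hu : σ.reg .u = 0) (hs : σ.reg .s = 0) (hβ : Table dbl x σ.bits) :
    wp prepare (fun τ N => MainInv (σ.reg .k) (σ.reg .n) x (σ.reg .err) τ 0 ∧ τ.reg .r = x ∧
      N ≤ 37 * x + 11) σ := by
  refine wp_seq ((wp_transfer (by decide) _).mono ?_)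
  rintro _ N₁ ⟨rfl, hN₁⟩
  refine wp_seq ((wp_scan isOrbit_dbl (R := x) ?_ ?_ ?_ ?_ ?_ ?_).mono ?_)
  · simp
  · simp [hr, hcell]
  · simpa using hd
  · simpa using hu
  · simpa using hs
  · exact hβ
  rintro τ N₂ ⟨⟨c, v, hi⟩, hr0, hN₂⟩
  have hτd : τ.reg .d ≤ x := by have := hi.d; have := hi.u; omega
  have hτu : τ.reg .u ≤ x := by have := hi.u; omega
  have hτs : τ.reg .s ≤ x := by
    by_contra hcon
    have := hi.g_le x (by omega)
    have := isOrbit_dbl.lt_orbit x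
    omega
  have hτk := hi.k
  have hτn := hi.n
  have hτe := hi.err
  simp at hτk hτn hτe
  refine wp_seq ((wp_transfer (by decide) _).mono ?_)
  rintro _ N₃ ⟨rfl, hN₃⟩
  refine wp_seq ((wp_clear _ _).mono ?_)
  rintro _ N₄ ⟨rfl, hN₄⟩
  refine wp_seq ((wp_clear _ _).mono ?_)
  rintro _ N₅ ⟨rfl, hN₅⟩
  refine (wp_clear _ _).mono ?_
  rintro _ N₆ ⟨rfl, hN₆⟩
  simp [hi.cell] at hN₃ hN₄ hN₅ hN₆
  refine ⟨⟨⟨?_, ?_, ?_, ?_⟩, ?_, ?_, ?_, Or.inl ⟨?_, ?_⟩⟩, ?_, ?_⟩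
  · simp
  · simp
  · simp
  · simp
  · simp [hτk]
  · simp [hτn]
  · simpa [hr0, hi.cell] using hi.table_g
  · simp [hr0, hi.cell, ackA_zero_left]
  · simp [hτe]
  · simp [hr0, hi.cell]
  · omega

/-- The whole decision procedure; an error is recorded if the answer is negative. -/
def decideGraph : Prog :=
  .seq (.seq measure rewind) <| .seq (decode .k .capK) <| .seq (decode .n .capN) <|
  .seq readPow <| .seq prepare <| .seq (.loop (.pos .k) descend) compare

theorem map_some_encodeTriple (k n m : ℕ) : (encodeTriple (k, n, m)).map some =
    digits (binaryRepr k) ++ some .sep ::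
      (digits (binaryRepr n) ++ some .sep :: digits (binaryRepr m)) := by
  simp [encodeTriple, digits, Function.comp_def]

theorem wp_decideGraph (k n m : ℕ) :
    wp decideGraph (fun σ N => (σ.reg .err = 0 ↔ ackA k n = m) ∧
      N ≤ 500 * (encodeTriple (k, n, m)).length) (Store.init (encodeTriple (k, n, m))) := by
  obtain ⟨b, ds, hm⟩ := List.exists_cons_of_ne_nil (binaryRepr_ne_nil m)
  set w := encodeTriple (k, n, m) with hw
  have hlen : w.length = (binaryRepr k).length + (binaryRepr n).length + ds.length + 3 := by
    simp [hw, encodeTriple, hm]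
    omega
  refine wp_seq ((wp_measure_rewind w).mono ?_)
  rintro σ₁ N₁ ⟨h₁, hN₁⟩
  have hin := h₁.input
  rw [hw, map_some_encodeTriple] at hin
  refine wp_seq ((wp_decode (by decide) (by decide) (by decide)
    (h₁.reg _ (by decide) (by decide)) (h₁.reg _ (by decide) (by decide)) hin).mono ?_)
  rintro σ₂ N₂ ⟨⟨l₂, hin₂⟩, hb₂, hr₂, hk₂, hN₂⟩
  have hz₂ : ∀ x, x ≠ .capK → x ≠ .capN → x ≠ .k → σ₂.reg x = 0 := fun x h h' h'' => by
    rw [hr₂ x h'' h, h₁.reg x h h']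
  refine wp_seq ((wp_decode (by decide) (by decide) (by decide)
    (hz₂ _ (by decide) (by decide) (by decide)) (hz₂ _ (by decide) (by decide) (by decide))
    hin₂).mono ?_)
  rintro σ₃ N₃ ⟨⟨l₃, hin₃⟩, hb₃, hr₃, hn₃, hN₃⟩
  have hz₃ : ∀ x, x ≠ .capK → x ≠ .capN → x ≠ .k → x ≠ .n → σ₃.reg x = 0 :=
    fun x h h' h'' h''' => by rw [hr₃ x h''' h', hz₂ x h h' h'']
  rw [hm] at hin₃
  refine wp_seq ((wp_readPow hin₃
    (hz₃ _ (by decide) (by decide) (by decide) (by decide))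
    (hz₃ _ (by decide) (by decide) (by decide) (by decide))
    (hz₃ _ (by decide) (by decide) (by decide) (by decide))
    (fun i => by rw [hb₃, hb₂, h₁.bits])).mono ?_)
  rintro σ₄ N₄ ⟨hcell₄, hβ₄, he₄, hr₄, hN₄⟩
  have hz₄ : ∀ x, x ≠ .capK → x ≠ .capN → x ≠ .k → x ≠ .n → x ≠ .cell → x ≠ .tmp → x ≠ .err →
      σ₄.reg x = 0 := fun x h1 h2 h3 h4 h5 h6 h7 => by rw [hr₄ x h5 h6 h7, hz₃ x h1 h2 h3 h4]
  have hk₄ : σ₄.reg .k = min k w.length := by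
    rw [hr₄ _ (by decide) (by decide) (by decide), hr₃ _ (by decide) (by decide), hk₂,
      appendDigits_binaryRepr, h₁.capK]
  have hn₄ : σ₄.reg .n = min n w.length := by
    rw [hr₄ _ (by decide) (by decide) (by decide), hn₃, appendDigits_binaryRepr,
      hr₂ _ (by decide) (by decide), h₁.capN]
  refine wp_seq ((wp_prepare hcell₄
    (hz₄ _ (by decide) (by decide) (by decide) (by decide) (by decide) (by decide) (by decide))
    (hz₄ _ (by decide) (by decide) (by decide) (by decide) (by decide) (by decide) (by decide))
    (hz₄ _ (by decide) (by decide) (by decide) (by decide) (by decide) (by decide) (by decide))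
    (hz₄ _ (by decide) (by decide) (by decide) (by decide) (by decide) (by decide) (by decide))
    hβ₄).mono ?_)
  rintro σ₅ N₅ ⟨h₅, hx₅, hN₅⟩
  refine wp_seq ((wp_main h₅).mono ?_)
  rintro σ₆ N₆ ⟨h₆, hx₆, hN₆⟩
  refine (wp_compare σ₆).mono ?_
  rintro σ₇ N₇ ⟨he₇, hN₇⟩
  have hn₆ := h₆.n
  constructor
  -- The descent has run with 2^x, x = `ds.length`, even if m is not that power; then the error from
  -- `readPow` decides.
  · rw [he₇, ackA_eq_iff (x := ds.length) (by rw [hm]; rfl),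
      ← ackA_min_eq_iff (k := k) (n := n) (L := w.length) (by omega), ← hk₄, ← hn₄, ← hn₆]
    have hpow : m = 2 ^ ds.length ↔ σ₄.reg .err = 0 := by
      rw [he₄, ← appendDigits_eq_two_pow, ← hm, appendDigits_binaryRepr]
    rw [hpow]
    rcases h₆.value with ⟨h1, h2⟩ | ⟨h1, h2, h3⟩
    · rw [h2, ← h1, (ackA_strictMono _).injective.eq_iff, eq_comm (a := σ₆.reg .r)]
    · refine iff_of_false (fun h => ?_) (fun h => h3 ⟨_, h.2⟩)
      omega
  · rw [h₁.capK] at hN₂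
    rw [hr₂ _ (by decide) (by decide), h₁.capN] at hN₃
    omega

end LinearCheck

open LinearCheck

theorem proposition5p4 : CheckableInLinearTime graphA := by
  -- The input is at most five times as long as its longest number, which has positive length. This
  -- gives the factor 500 · 5, and the rest of 3000 absorbs the three extra steps of
  -- `decidesWithin_machine`.
  refine ⟨_, 3000, fun k n m => decidesWithin_machine (p := decideGraph) (t := .pos .err) ?_⟩
  refine (wp_decideGraph k n m).mono fun σ N h => ⟨?_, ?_⟩
  · simpa [Test.eval, graphA] using h.1
  · have hlen : (encodeTriple (k, n, m)).length =
        binaryLength k + binaryLength n + binaryLength m + 2 := by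
      simp [encodeTriple, binaryLength]
      omega
    have h0 : 0 < binaryLength k := List.length_pos_of_ne_nil (binaryRepr_ne_nil k)
    have h1 := h.2
    rw [hlen] at h1
    omega
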